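/- Let $(M,g)$ be a surface, that is, a connected orientable smooth Riemannian two-manifold with or without boundary, and fix an orientation of $M$, with Riemannian area form $\mathrm{dVol}_g$. A hydrodynamic Killing vector field on $(M,g)$ is a vector field $X$ of class $C^r$, $r\ge 1$, such that $\mathcal{L}_X g=0$, $X\not\equiv 0$, and $X(p)\in T_p\partial M$ for every $p\in\partial M$. The vorticity of a $C^r$ vector field $v$, $r\ge 1$, is the function $\omega$ on $M$ defined by $\omega\,\mathrm{dVol}_g=d v^\flat$, where $v^\flat=g(v,\cdot)$. Let $X$ be a hydrodynamic Killing vector field on $(M,g)$. Then the vorticity of $X$ is constant on $M$ if and only if the Gaussian curvature of $(M,g)$ vanishes identically on $M$. -/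

import Mathlib

open Set Filter Topology Bundle Manifold
open scoped ContDiff

noncomputable section

namespace Surf

/-- The coordinate plane `ℝ²`. -/
abbrev Plane : Type := EuclideanSpace ℝ (Fin 2)

/-- The model with corners `I` is a model for surfaces with or without boundary: its image is
either the whole plane or the closed half-plane `{y | 0 ≤ y 0}`. The two standard instances are
`𝓡 2` and `𝓡∂ 2`. -/
def IsSurfaceModel {H : Type*} [TopologicalSpace H] (I : ModelWithCorners ℝ Plane H) : Prop :=
  range I = univ ∨ range I = {y : Plane | 0 ≤ y 0}

section Coordinates

variable {H : Type*} [TopologicalSpace H] (I : ModelWithCorners ℝ Plane H)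

/-- The partial derivative `∂ᵢ f` at `x`, one-sided at the points of the boundary of the
half-plane. -/
def partialD (i : Fin 2) (f : Plane → ℝ) (x : Plane) : ℝ :=
  fderivWithin ℝ f (range I) x (EuclideanSpace.single i 1)

variable {M : Type*} [TopologicalSpace M] [ChartedSpace H M]

/-- The coordinate vector `∂ᵢ` of the chart `e`, at the point of `M` with coordinates `x`. -/
def coordVec (e : OpenPartialHomeomorph M H) (i : Fin 2) (x : Plane) :
    TangentSpace I ((e.extend I).symm x) :=
  mfderivWithin 𝓘(ℝ, Plane) I (e.extend I).symm (range I) x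
    (EuclideanSpace.single i (1 : ℝ) : Plane)

/-- The component `Xᵏ` of the vector field `X` in the chart `e`, as a function of the
coordinates. -/
def vecCoeff (e : OpenPartialHomeomorph M H) (X : ∀ p : M, TangentSpace I p)
    (k : Fin 2) (x : Plane) : ℝ :=
  (show Plane from mfderiv I 𝓘(ℝ, Plane) (e.extend I) ((e.extend I).symm x)
    (X ((e.extend I).symm x))) k

end Coordinates

section Orientation

variable {H : Type*} [TopologicalSpace H] (I : ModelWithCorners ℝ Plane H)
variable (M : Type*) [TopologicalSpace M] [ChartedSpace H M]

/-- The pair `(v, w)` is a positively oriented basis of the oriented real vector space `V`. -/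
def IsPositivePair {V : Type*} [AddCommGroup V] [Module ℝ V]
    (o : _root_.Orientation ℝ V (Fin 2)) (v w : V) : Prop :=
  ∃ b : Module.Basis (Fin 2) ℝ V, b 0 = v ∧ b 1 = w ∧ b.orientation = o

/-- An orientation of the surface `M`: an orientation of every tangent plane, which varies
continuously, i.e. the coordinate frame of a chart keeps its sign locally. -/
structure SurfaceOrientation where
  /-- the orientation of the tangent plane at a point -/
  at_point : ∀ p : M, _root_.Orientation ℝ (TangentSpace I p) (Fin 2)
  locally_constant : ∀ e ∈ atlas H M, ∀ x ∈ (e.extend I).target,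
    ∀ᶠ y in 𝓝[range I] x,
      (IsPositivePair (at_point ((e.extend I).symm y)) (coordVec I e 0 y) (coordVec I e 1 y) ↔
        IsPositivePair (at_point ((e.extend I).symm x)) (coordVec I e 0 x) (coordVec I e 1 x))

end Orientation

section Metric

variable {H : Type*} [TopologicalSpace H] {I : ModelWithCorners ℝ Plane H}
variable {M : Type*} [TopologicalSpace M] [ChartedSpace H M] [IsManifold I ∞ M]

/-- The type of smooth Riemannian metrics on the surface `M`. -/
abbrev Metric (I : ModelWithCorners ℝ Plane H) (M : Type*) [TopologicalSpace M] [ChartedSpace H M]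
    [IsManifold I ∞ M] : Type _ :=
  ContMDiffRiemannianMetric I ∞ Plane (fun p : M => TangentSpace I p)

variable (g : Metric I M)

/-- The coefficient `gᵢⱼ = g(∂ᵢ, ∂ⱼ)` of the metric in the chart `e`. -/
def metricCoeff (e : OpenPartialHomeomorph M H) (i j : Fin 2) (x : Plane) : ℝ :=
  g.inner ((e.extend I).symm x) (coordVec I e i x) (coordVec I e j x)

/-- The matrix `(gᵢⱼ)` of the metric in the chart `e`. -/
def metricMatrix (e : OpenPartialHomeomorph M H) (x : Plane) : Matrix (Fin 2) (Fin 2) ℝ :=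
  Matrix.of fun i j => metricCoeff g e i j x

/-- The Christoffel symbol
`Γᵏᵢⱼ = ½ gᵏˡ (∂ᵢ gⱼₗ + ∂ⱼ gᵢₗ - ∂ₗ gᵢⱼ)` of the metric in the chart `e`. -/
def christoffel (e : OpenPartialHomeomorph M H) (k i j : Fin 2) (x : Plane) : ℝ :=
  (1 / 2) * ∑ l, (metricMatrix g e x)⁻¹ k l *
    (partialD I i (metricCoeff g e j l) x + partialD I j (metricCoeff g e i l) x
      - partialD I l (metricCoeff g e i j) x)

/-- The component `Rˡ` of the curvature vector `R(∂₀, ∂₁) ∂₁ = Rˡ ∂ₗ` in the chart `e`, where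
`R(Y, Z) = ∇_Y ∇_Z - ∇_Z ∇_Y - ∇_[Y, Z]`. -/
def riemannCoeff (e : OpenPartialHomeomorph M H) (l : Fin 2) (x : Plane) : ℝ :=
  partialD I 0 (christoffel g e l 1 1) x - partialD I 1 (christoffel g e l 0 1) x
    + ∑ m, (christoffel g e l 0 m x * christoffel g e m 1 1 x
      - christoffel g e l 1 m x * christoffel g e m 0 1 x)

/-- The Gaussian curvature
`K = g(R(∂₀, ∂₁) ∂₁, ∂₀) / (g₀₀ g₁₁ - g₀₁²)` at `p`, computed in the preferred chart
at `p` (it does not depend on the chart). -/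
def gaussCurvature (p : M) : ℝ :=
  (∑ l, metricCoeff g (chartAt H p) 0 l (extChartAt I p p) *
      riemannCoeff g (chartAt H p) l (extChartAt I p p)) /
    (metricMatrix g (chartAt H p) (extChartAt I p p)).det

/-- The component `(𝓛_X g)ᵢⱼ = Xᵏ ∂ₖ gᵢⱼ + gₖⱼ ∂ᵢ Xᵏ + gᵢₖ ∂ⱼ Xᵏ` of the Lie derivative of the
metric along `X` in the chart `e`. -/
def lieDerivMetric (X : ∀ p : M, TangentSpace I p) (e : OpenPartialHomeomorph M H)
    (i j : Fin 2) (x : Plane) : ℝ :=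
  ∑ k, (vecCoeff I e X k x * partialD I k (metricCoeff g e i j) x
    + metricCoeff g e k j x * partialD I i (vecCoeff I e X k) x
    + metricCoeff g e i k x * partialD I j (vecCoeff I e X k) x)

/-- A hydrodynamic Killing vector field: a vector field of class `C¹` with `𝓛_X g = 0`, not
identically zero, and tangent to the boundary. In a chart onto an open part of the half-plane
`{y | 0 ≤ y 0}`, a vector at a boundary point is tangent to the boundary iff its component of
index `0` vanishes. -/
structure IsHydrodynamicKilling (X : ∀ p : M, TangentSpace I p) : Prop where
  contMDiff : ContMDiff I I.tangent 1 (fun p : M => (⟨p, X p⟩ : TangentBundle I M))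
  lieDeriv_eq_zero : ∀ e ∈ atlas H M, ∀ x ∈ (e.extend I).target, ∀ i j : Fin 2,
    lieDerivMetric g X e i j x = 0
  nontrivial : ∃ p : M, X p ≠ 0
  tangent_boundary : ∀ p ∈ I.boundary M, ∀ e ∈ atlas H M, p ∈ e.source →
    vecCoeff I e X 0 (e.extend I p) = 0

open Classical in
/-- The Riemannian area form `dVol_g` of the oriented surface: on a positively oriented pair its
value is the area `√(g(v,v) g(w,w) - g(v,w)²)` of the parallelogram, on a negatively oriented
pair minus that area, on a linearly dependent pair `0`. -/
def areaForm (o : SurfaceOrientation I M) (p : M) (v w : TangentSpace I p) : ℝ :=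
  if IsPositivePair (o.at_point p) v w then
    √(g.inner p v v * g.inner p w w - g.inner p v w ^ 2)
  else -√(g.inner p v v * g.inner p w w - g.inner p v w ^ 2)

/-- The component `vᵢ = g(v, ∂ᵢ)` of the velocity form `v♭ = g(v, ·)` in the chart `e`. -/
def flatCoeff (v : ∀ p : M, TangentSpace I p) (e : OpenPartialHomeomorph M H)
    (i : Fin 2) (x : Plane) : ℝ :=
  g.inner ((e.extend I).symm x) (v ((e.extend I).symm x)) (coordVec I e i x)

/-- The vorticity `ω` of the vector field `v`, defined by `ω dVol_g = d v♭`: both sides are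
evaluated at `p` on the coordinate frame `(∂₀, ∂₁)` of the preferred chart at `p`, where
`d v♭ (∂₀, ∂₁) = ∂₀ v₁ - ∂₁ v₀` (the quotient does not depend on the chart). -/
def vorticity (o : SurfaceOrientation I M) (v : ∀ p : M, TangentSpace I p) (p : M) : ℝ :=
  (partialD I 0 (flatCoeff g v (chartAt H p) 1) (extChartAt I p p)
      - partialD I 1 (flatCoeff g v (chartAt H p) 0) (extChartAt I p p)) /
    areaForm g o (((chartAt H p).extend I).symm (extChartAt I p p))
      (coordVec I (chartAt H p) 0 (extChartAt I p p))
      (coordVec I (chartAt H p) 1 (extChartAt I p p))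

end Metric

end Surf

end

/-! Everything rests on the identity `dω = 2 K ι_X dVol` for a Killing field `X`. Lowering the index
turns `𝓛_X g = 0` into `∂ᵢXⱼ + ∂ⱼXᵢ = 2 Γᵐᵢⱼ Xₘ`, so the symmetric part of the first derivatives of
`X♭` is an expression in `X♭` itself. Differentiating once more expresses the derivative of the curl
through the curvature tensor (`IsHydrodynamicKilling.hasFDerivAt_curl`), and division by `√det g`
removes the Christoffel traces (`IsHydrodynamicKilling.hasFDerivAt_chartVorticity`). Since `X` is
only `C¹`, its curl is a priori merely continuous; the Peano form of the symmetry of mixed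
derivatives supplies the missing differentiability (`hasFDerivAt_curl`).

If `K = 0`, then `dω = 0` at interior points; continuity up to the boundary and connectedness make
`ω` constant (`eq_of_hasFDerivAt_zero`).

Conversely, let `ω` be constant and suppose `K ≠ 0` at a point. Then `ι_X dVol = 0`, hence `X = 0`,
on a nonempty open set of interior points. There `ω = 0`, so `ω` vanishes everywhere. The covariant
derivative of `X` is antisymmetric by the Killing equation and symmetric because `X♭` is closed, so
it is zero and `|X|²` is constant (`IsHydrodynamicKilling.inner_self_eq`). Having a zero, `X`
vanishes identically, which is excluded. -/

namespace Surf

/-! ### Charts, coordinate frames and regularity of components. -/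

section Charts

variable {H : Type*} [TopologicalSpace H] {I : ModelWithCorners ℝ Plane H}
variable {M : Type*} [TopologicalSpace M]

lemma extend_target_mem_nhdsWithin_range (e : OpenPartialHomeomorph M H) {x : Plane}
    (hx : x ∈ (e.extend I).target) : (e.extend I).target ∈ 𝓝[range I] x := by
  have := e.extend_target_mem_nhdsWithin (I := I) (y := (e.extend I).symm x)
    (by simpa using (e.extend I).map_target hx)
  rwa [(e.extend I).right_inv hx] at this

lemma mem_range_of_mem_target {e : OpenPartialHomeomorph M H} {x : Plane}
    (hx : x ∈ (e.extend I).target) : x ∈ range I :=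
  e.extend_target_subset_range hx

lemma symm_mem_source {e : OpenPartialHomeomorph M H} {x : Plane}
    (hx : x ∈ (e.extend I).target) : (e.extend I).symm x ∈ e.source := by
  simpa using (e.extend I).map_target hx

lemma extend_mem_target {e : OpenPartialHomeomorph M H} {q : M} (hq : q ∈ e.source) :
    e.extend I q ∈ (e.extend I).target :=
  (e.extend I).map_source (by simpa using hq)

variable [ChartedSpace H M] [IsManifold I ∞ M]

lemma contMDiffWithinAt_extend_symm {e : OpenPartialHomeomorph M H} (he : e ∈ atlas H M)
    {x : Plane} (hx : x ∈ (e.extend I).target) :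
    ContMDiffWithinAt 𝓘(ℝ, Plane) I ∞ (e.extend I).symm (range I) x := by
  have h := contMDiffOn_extend_symm (I := I) (n := ∞)
    (IsManifold.subset_maximalAtlas (I := I) (n := ∞) he)
  rw [← e.extend_target'] at h
  exact (h x hx).mono_of_mem_nhdsWithin (extend_target_mem_nhdsWithin_range e hx)

lemma contMDiffAt_extend {e : OpenPartialHomeomorph M H} (he : e ∈ atlas H M)
    {q : M} (hq : q ∈ e.source) :
    ContMDiffAt I 𝓘(ℝ, Plane) ∞ (e.extend I) q :=
  e.contMDiffAt_extend (IsManifold.subset_maximalAtlas he) hq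

lemma mfderiv_extend_comp_symm {e : OpenPartialHomeomorph M H} (he : e ∈ atlas H M)
    {x : Plane} (hx : x ∈ (e.extend I).target) :
    (mfderiv I 𝓘(ℝ, Plane) (e.extend I) ((e.extend I).symm x)).comp
      (mfderivWithin 𝓘(ℝ, Plane) I (e.extend I).symm (range I) x) =
        ContinuousLinearMap.id ℝ (TangentSpace 𝓘(ℝ, Plane) x) := by
  have hU : UniqueMDiffWithinAt 𝓘(ℝ, Plane) (range I) x :=
    uniqueMDiffWithinAt_iff_uniqueDiffWithinAt.2 (I.uniqueDiffOn _ (mem_range_of_mem_target hx))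
  rw [← mfderiv_comp_mfderivWithin x
    ((contMDiffAt_extend he (symm_mem_source hx)).mdifferentiableAt (by simp))
    ((contMDiffWithinAt_extend_symm he hx).mdifferentiableWithinAt (by simp)) hU,
    ← mfderivWithin_id hU]
  apply Filter.EventuallyEq.mfderivWithin_eq
  · filter_upwards [extend_target_mem_nhdsWithin_range e hx] with y hy
    exact (e.extend I).right_inv hy
  · exact (e.extend I).right_inv hx

lemma mfderiv_symm_comp_extend {e : OpenPartialHomeomorph M H} (he : e ∈ atlas H M)
    {x : Plane} (hx : x ∈ (e.extend I).target) :
    (mfderivWithin 𝓘(ℝ, Plane) I (e.extend I).symm (range I) x).comp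
      (mfderiv I 𝓘(ℝ, Plane) (e.extend I) ((e.extend I).symm x)) =
        ContinuousLinearMap.id ℝ (TangentSpace I ((e.extend I).symm x)) := by
  have h := mfderiv_extend_comp_symm he hx
  set A : Plane →L[ℝ] Plane := mfderiv I 𝓘(ℝ, Plane) (e.extend I) ((e.extend I).symm x)
  set B : Plane →L[ℝ] Plane := mfderivWithin 𝓘(ℝ, Plane) I (e.extend I).symm (range I) x
  -- Every tangent space unfolds to `Plane`, so `A` and `B` are endomorphisms of one
  -- finite-dimensional space, where a one-sided inverse is two-sided.
  have h1 : A.toLinearMap ∘ₗ B.toLinearMap = LinearMap.id := by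
    ext1 v
    exact congrArg (fun L : Plane →L[ℝ] Plane => L v) h
  have h2 := (LinearMap.comp_eq_id_comm ℝ Plane).1 h1
  ext1 v
  exact congrArg (fun L : Plane →ₗ[ℝ] Plane => L v) h2

/-- A tangent vector is the combination of the coordinate vectors given by its components. -/
lemma eq_sum_vecCoeff_smul {e : OpenPartialHomeomorph M H} (he : e ∈ atlas H M)
    (X : ∀ p : M, TangentSpace I p) {x : Plane} (hx : x ∈ (e.extend I).target) :
    X ((e.extend I).symm x) =
      vecCoeff I e X 0 x • coordVec I e 0 x + vecCoeff I e X 1 x • coordVec I e 1 x := by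
  have h := congrArg (fun L : Plane →L[ℝ] Plane => L (X ((e.extend I).symm x)))
    (mfderiv_symm_comp_extend he hx)
  set B : Plane →L[ℝ] Plane := mfderivWithin 𝓘(ℝ, Plane) I (e.extend I).symm (range I) x with hB
  set w : Plane := mfderiv I 𝓘(ℝ, Plane) (e.extend I) ((e.extend I).symm x)
    (X ((e.extend I).symm x)) with hw
  have h' : B w = X ((e.extend I).symm x) := h
  have hsum : w = w 0 • EuclideanSpace.single 0 (1 : ℝ) + w 1 • EuclideanSpace.single 1 (1 : ℝ) := by
    ext i
    fin_cases i <;> simp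
  have h2 : B w = w 0 • B (EuclideanSpace.single 0 (1 : ℝ))
      + w 1 • B (EuclideanSpace.single 1 (1 : ℝ)) := by
    conv_lhs => rw [hsum]
    simp only [map_add, map_smul]
  exact h'.symm.trans h2

/-- The coordinate frame of a chart is linearly independent. -/
lemma linearIndependent_coordVec {e : OpenPartialHomeomorph M H} (he : e ∈ atlas H M)
    {x : Plane} (hx : x ∈ (e.extend I).target) :
    LinearIndependent ℝ ![coordVec I e 0 x, coordVec I e 1 x] := by
  rw [LinearIndependent.pair_iff]
  intro s t hst
  have h := mfderiv_extend_comp_symm he hx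
  set A : Plane →L[ℝ] Plane := mfderiv I 𝓘(ℝ, Plane) (e.extend I) ((e.extend I).symm x)
  set B : Plane →L[ℝ] Plane := mfderivWithin 𝓘(ℝ, Plane) I (e.extend I).symm (range I) x
  have h1 : ∀ v : Plane, A (B v) = v := fun v => congrArg (fun L : Plane →L[ℝ] Plane => L v) h
  have h2 : s • B (EuclideanSpace.single 0 (1 : ℝ))
      + t • B (EuclideanSpace.single 1 (1 : ℝ)) = 0 := hst
  have h3 := congrArg A h2
  simp only [map_add, map_smul, h1, map_zero] at h3
  have h30 := congrArg (fun v : Plane => v 0) h3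
  have h31 := congrArg (fun v : Plane => v 1) h3
  simp at h30 h31
  exact ⟨h30, h31⟩

/-- The coordinate field is the tangent map of the inverse chart applied to a constant field. The
derivative is taken within the chart target, then compared with the one within `range I`. -/
lemma contMDiffWithinAt_coordVec {e : OpenPartialHomeomorph M H} (he : e ∈ atlas H M)
    (i : Fin 2) {x : Plane} (hx : x ∈ (e.extend I).target) :
    ContMDiffWithinAt 𝓘(ℝ, Plane) I.tangent ∞
      (fun y => (⟨(e.extend I).symm y, coordVec I e i y⟩ : TangentBundle I M)) (range I) x := by
  have hT : UniqueMDiffOn 𝓘(ℝ, Plane) (e.extend I).target := by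
    rw [uniqueMDiffOn_iff_uniqueDiffOn, e.extend_target]
    exact I.uniqueDiffOn_preimage e.open_target
  have : IsManifold I 1 M := IsManifold.of_le (n := ∞) (by simp)
  have hsymm : ContMDiffOn 𝓘(ℝ, Plane) I ∞ (e.extend I).symm (e.extend I).target :=
    fun y hy => (contMDiffWithinAt_extend_symm he hy).mono e.extend_target_subset_range
  have h1 := hsymm.contMDiffOn_tangentMapWithin (m := ∞) (by simp) hT
  have h2 : ContMDiffWithinAt 𝓘(ℝ, Plane) 𝓘(ℝ, Plane).tangent ∞
      (fun y : Plane => (⟨y, EuclideanSpace.single i (1 : ℝ)⟩ : TangentBundle 𝓘(ℝ, Plane) Plane))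
      (e.extend I).target x :=
    contMDiffWithinAt_vectorSpace_iff_contDiffWithinAt.2 contDiffWithinAt_const
  have h3 := (h1 ⟨x, EuclideanSpace.single i (1 : ℝ)⟩ hx).comp x h2 (fun y hy => hy)
  refine ((h3.congr_of_mem ?_ hx)).mono_of_mem_nhdsWithin (extend_target_mem_nhdsWithin_range e hx)
  intro y hy
  simp only [Function.comp, tangentMapWithin, coordVec]
  congr 2
  rw [mfderivWithin_subset e.extend_target_subset_range (hT y hy)
    ((contMDiffWithinAt_extend_symm he hy).mdifferentiableWithinAt (by simp))]

lemma contDiffWithinAt_metricCoeff (g : Metric I M) {e : OpenPartialHomeomorph M H}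
    (he : e ∈ atlas H M) (i j : Fin 2) {x : Plane} (hx : x ∈ (e.extend I).target) :
    ContDiffWithinAt ℝ ∞ (metricCoeff g e i j) (range I) x := by
  have h : ContMDiffWithinAt 𝓘(ℝ, Plane) (I.prod 𝓘(ℝ)) ∞
      (fun y => TotalSpace.mk' ℝ (E := Bundle.Trivial M ℝ) ((e.extend I).symm y)
        (metricCoeff g e i j y)) (range I) x := by
    apply ContMDiffWithinAt.clm_bundle_apply₂ (F₁ := Plane) (F₂ := Plane)
    · exact ContMDiffAt.comp_contMDiffWithinAt x g.contMDiff.contMDiffAt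
        (contMDiffWithinAt_extend_symm he hx)
    · exact contMDiffWithinAt_coordVec he i hx
    · exact contMDiffWithinAt_coordVec he j hx
  simp only [contMDiffWithinAt_totalSpace] at h
  exact h.2.contDiffWithinAt

/-- The components are the fibre part of the tangent map of the chart composed with `X`; the chart
is smooth, so only the `C¹` regularity of `X` limits the result. -/
lemma contDiffWithinAt_vecCoeff {X : ∀ p : M, TangentSpace I p}
    (hX : ContMDiff I I.tangent 1 (fun p : M => (⟨p, X p⟩ : TangentBundle I M)))
    {e : OpenPartialHomeomorph M H} (he : e ∈ atlas H M) (k : Fin 2) {x : Plane}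
    (hx : x ∈ (e.extend I).target) :
    ContDiffWithinAt ℝ 1 (vecCoeff I e X k) (range I) x := by
  have : IsManifold I 1 M := IsManifold.of_le (n := ∞) (by simp)
  have h1 : ContMDiffOn I.tangent 𝓘(ℝ, Plane).tangent 1 (tangentMapWithin I 𝓘(ℝ, Plane)
      (e.extend I) e.source) (π Plane (TangentSpace I) ⁻¹' e.source) :=
    ContMDiffOn.contMDiffOn_tangentMapWithin (n := ∞)
      (fun q hq => (contMDiffAt_extend he hq).contMDiffWithinAt)
      (by norm_num; exact WithTop.coe_le_coe.2 le_top) e.open_source.uniqueMDiffOn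
  have h2 : ContMDiffWithinAt 𝓘(ℝ, Plane) I.tangent 1
      (fun y => (⟨(e.extend I).symm y, X ((e.extend I).symm y)⟩ : TangentBundle I M))
      (e.extend I).target x :=
    (hX.contMDiffAt.comp_contMDiffWithinAt x
      ((contMDiffWithinAt_extend_symm he hx).of_le (by simp))).mono e.extend_target_subset_range
  have h3 := (h1 ⟨_, X ((e.extend I).symm x)⟩ (symm_mem_source hx)).comp x h2 (fun y hy => symm_mem_source hy)
  have h4 := ((contMDiff_snd_tangentBundle_modelSpace Plane 𝓘(ℝ, Plane)
    (n := 1)).contMDiffAt.comp_contMDiffWithinAt x h3).contDiffWithinAt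
  have h5 : ContDiffWithinAt ℝ 1 (fun y => (show Plane from
      mfderiv I 𝓘(ℝ, Plane) (e.extend I) ((e.extend I).symm y) (X ((e.extend I).symm y))))
      (e.extend I).target x := by
    refine h4.congr_of_mem (fun y hy => ?_) hx
    simp only [Function.comp, tangentMapWithin]
    rw [mfderivWithin_of_isOpen e.open_source (symm_mem_source hy)]
  have h6 := h5.mono_of_mem_nhdsWithin (extend_target_mem_nhdsWithin_range e hx)
  exact (contDiffWithinAt_euclidean.1 h6) k

end Charts

/-! ### Mixed partial derivatives under weak regularity. -/

section Calculus

/-- Peano's form of the symmetry of mixed partial derivatives: if the derivative of `f` along `w`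
is strictly differentiable at `x`, then the derivative of `f` along `v` is differentiable along `w`
at `x`, and the mixed derivatives agree. -/
lemma hasDerivAt_fderiv_of_hasStrictFDerivAt {E : Type*} [NormedAddCommGroup E] [NormedSpace ℝ E]
    {f h : E → ℝ} {h' : E →L[ℝ] ℝ} {x : E} (v w : E)
    (hf : ∀ᶠ y in 𝓝 x, DifferentiableAt ℝ f y) (hw : ∀ᶠ y in 𝓝 x, fderiv ℝ f y w = h y)
    (hh : HasStrictFDerivAt h h' x) :
    HasDerivAt (fun t : ℝ => fderiv ℝ f (x + t • w) v) (h' v) 0 := by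
  rw [hasDerivAt_iff_isLittleO, Asymptotics.isLittleO_iff]
  intro ε hε
  obtain ⟨c, hc, hcv⟩ : ∃ c : ℝ, 0 < c ∧ c * ‖v‖ ≤ ε := by
    refine ⟨ε / (‖v‖ + 1), by positivity, ?_⟩
    rw [div_mul_eq_mul_div, div_le_iff₀ (by positivity)]
    nlinarith [norm_nonneg v]
  have hs := (Asymptotics.isLittleO_iff.1 hh.isLittleO) hc
  rw [nhds_prod_eq] at hs
  obtain ⟨r, hr, hball⟩ : ∃ r > 0, ∀ y ∈ Metric.ball x r, ∀ z ∈ Metric.ball x r,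
      ‖h y - h z - h' (y - z)‖ ≤ c * ‖y - z‖ := by
    obtain ⟨p, hp, q, hq, hpq⟩ := Filter.eventually_prod_iff.1 hs
    obtain ⟨r, hr, hrs⟩ := Metric.eventually_nhds_iff_ball.1 (hp.and hq)
    exact ⟨r, hr, fun y hy z hz => hpq (hrs y hy).1 (hrs z hz).2⟩
  obtain ⟨r', hr', hball'⟩ := Metric.eventually_nhds_iff_ball.1 (hf.and hw)
  set ρ := min r r' with hρ
  have hρ0 : 0 < ρ := lt_min hr hr'
  -- Chosen so that the parallelogram with sides `t • w` and `u • v` stays in the ball where all the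
  -- estimates hold.
  set δ := ρ / (‖v‖ + ‖w‖ + 1) with hδ
  have hδ0 : 0 < δ := by positivity
  have hmem : ∀ s u : ℝ, |s| < δ → |u| < δ → x + s • w + u • v ∈ Metric.ball x ρ := by
    intro s u hs hu
    rw [mem_ball_iff_norm, show x + s • w + u • v - x = s • w + u • v by abel]
    calc ‖s • w + u • v‖ ≤ |s| * ‖w‖ + |u| * ‖v‖ := by
          simpa [norm_smul] using norm_add_le (s • w) (u • v)
      _ ≤ δ * ‖w‖ + δ * ‖v‖ := by gcongr
      _ < δ * (‖v‖ + ‖w‖ + 1) := by nlinarith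
      _ = ρ := by rw [hδ]; field_simp
  have hmem0 : ∀ s : ℝ, |s| < δ → x + s • w ∈ Metric.ball x ρ := by
    intro s hs
    simpa using hmem s 0 hs (by simpa using hδ0)
  have hd : ∀ y ∈ Metric.ball x ρ, DifferentiableAt ℝ f y := fun y hy =>
    (hball' y (Metric.ball_subset_ball (min_le_right _ _) hy)).1
  have hdw : ∀ y ∈ Metric.ball x ρ, fderiv ℝ f y w = h y := fun y hy =>
    (hball' y (Metric.ball_subset_ball (min_le_right _ _) hy)).2
  have hline : ∀ (z d : E) (s : ℝ), z + s • d ∈ Metric.ball x ρ →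
      HasDerivAt (fun s : ℝ => f (z + s • d)) (fderiv ℝ f (z + s • d) d) s := by
    intro z d s hz
    have h1 : HasDerivAt (fun s : ℝ => z + s • d) d s := by
      simpa using ((hasDerivAt_id s).smul_const d).const_add z
    exact (hd _ hz).hasFDerivAt.comp_hasDerivAt s h1
  rw [Metric.eventually_nhds_iff]
  refine ⟨δ, hδ0, fun t ht => ?_⟩
  have ht' : |t| < δ := by simpa using ht
  -- The second difference of `f` over the parallelogram is compared with `t u h'(v)`. The mean
  -- value inequality is applied along `w`, the direction in which the derivative of `f` is the
  -- known function `h`.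
  have key : ∀ u : ℝ, |u| < δ →
      ‖(f (x + t • w + u • v) - f (x + u • v) - u * (t * h' v)) - (f (x + t • w) - f x)‖
        ≤ c * ‖v‖ * |t| * |u| := by
    intro u hu
    have hψ : ∀ s ∈ Metric.ball (0 : ℝ) δ, HasDerivWithinAt
        (fun s : ℝ => f ((x + u • v) + s • w) - f (x + s • w) - s * (u * h' v))
        (h ((x + u • v) + s • w) - h (x + s • w) - u * h' v) (Metric.ball (0 : ℝ) δ) s := by
      intro s hs
      have hs' : |s| < δ := by simpa using hs
      have m1 : (x + u • v) + s • w ∈ Metric.ball x ρ := by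
        rw [add_right_comm]; exact hmem s u hs' hu
      have h1 := hline (x + u • v) w s m1
      have h2 := hline x w s (hmem0 s hs')
      rw [hdw _ m1] at h1
      rw [hdw _ (hmem0 s hs')] at h2
      have h3 : HasDerivAt (fun s : ℝ => s * (u * h' v)) (u * h' v) s := by
        simpa using (hasDerivAt_id s).mul_const (u * h' v)
      exact ((h1.sub h2).sub h3).hasDerivWithinAt
    have hb : ∀ s ∈ Metric.ball (0 : ℝ) δ,
        ‖h ((x + u • v) + s • w) - h (x + s • w) - u * h' v‖ ≤ c * (|u| * ‖v‖) := by
      intro s hs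
      have hs' : |s| < δ := by simpa using hs
      have m1 : (x + u • v) + s • w ∈ Metric.ball x ρ := by
        rw [add_right_comm]; exact hmem s u hs' hu
      have := hball _ (Metric.ball_subset_ball (min_le_left _ _) m1) _
        (Metric.ball_subset_ball (min_le_left _ _) (hmem0 s hs'))
      rw [show (x + u • v) + s • w - (x + s • w) = u • v by abel, map_smul, norm_smul] at this
      simpa using this
    have := (convex_ball (0 : ℝ) δ).norm_image_sub_le_of_norm_hasDerivWithin_le hψ hb
      (Metric.mem_ball_self hδ0) (show t ∈ Metric.ball (0 : ℝ) δ by simpa using ht')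
    simp only [zero_smul, add_zero, zero_mul, sub_zero, Real.norm_eq_abs] at this ⊢
    rw [add_right_comm x (u • v) (t • w)] at this
    calc _ = |f (x + t • w + u • v) - f (x + t • w) - t * (u * h' v) - (f (x + u • v) - f x)| := by
          congr 1; ring
      _ ≤ _ := this
      _ = _ := by ring
  have hder : HasDerivAt
      (fun u : ℝ => f ((x + t • w) + u • v) - f (x + u • v) - u * (t * h' v))
      (fderiv ℝ f (x + t • w) v - fderiv ℝ f x v - t * h' v) 0 := by
    have h1 := hline (x + t • w) v 0 (by simpa using hmem0 t ht')
    have h2 := hline x v 0 (by simpa using hρ0)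
    have h3 : HasDerivAt (fun s : ℝ => s * (t * h' v)) (t * h' v) 0 := by
      simpa using (hasDerivAt_id (0 : ℝ)).mul_const (t * h' v)
    simp only [zero_smul, add_zero] at h1 h2
    exact (h1.sub h2).sub h3
  -- Letting `u` tend to `0` turns the bound on second differences into a bound on the increment of
  -- the derivative along `v`.
  have hle := hder.le_of_lip' (C := c * ‖v‖ * |t|) (by positivity) (by
    rw [Metric.eventually_nhds_iff]
    refine ⟨δ, hδ0, fun u hu => ?_⟩
    simpa using key u (by simpa using hu))
  simp only [zero_smul, add_zero, sub_zero, smul_eq_mul]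
  refine hle.trans ?_
  rw [Real.norm_eq_abs]
  gcongr

/-- A function on the plane whose two partial derivatives exist near a point and are continuous
there is differentiable at the point. -/
lemma hasFDerivAt_of_partial {W D₀ D₁ : Plane → ℝ} {x : Plane}
    (h₀ : ∀ᶠ y in 𝓝 x, HasDerivAt (fun t : ℝ => W (y + t • EuclideanSpace.single 0 1)) (D₀ y) 0)
    (h₁ : ∀ᶠ y in 𝓝 x, HasDerivAt (fun t : ℝ => W (y + t • EuclideanSpace.single 1 1)) (D₁ y) 0)
    (c₀ : ContinuousAt D₀ x) (c₁ : ContinuousAt D₁ x) :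
    HasFDerivAt W (D₀ x • EuclideanSpace.proj 0 + D₁ x • EuclideanSpace.proj 1 : Plane →L[ℝ] ℝ)
      x := by
  set e₀ : Plane := EuclideanSpace.single 0 1
  set e₁ : Plane := EuclideanSpace.single 1 1
  set P : ℝ × ℝ → Plane := fun v => x + v.1 • e₀ + v.2 • e₁ with hP
  have hPc : Tendsto P (𝓝 (0, 0)) (𝓝 x) := by
    have : Continuous P := by fun_prop
    simpa [hP] using this.tendsto (0, 0)
  have hP0 : P (0, 0) = x := by simp [hP]
  have shift : ∀ (D : ℝ) (z d : Plane) (s : ℝ),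
      HasDerivAt (fun t : ℝ => W ((z + s • d) + t • d)) D 0 →
      HasDerivAt (fun t : ℝ => W (z + t • d)) D s := by
    intro D z d s h
    have h2 : HasDerivAt (fun t : ℝ => t - s) 1 s := (hasDerivAt_id s).sub_const s
    have h3 := HasDerivAt.comp s (h₂ := fun t : ℝ => W ((z + s • d) + t • d)) (h := fun t => t - s)
      (by simpa using h) h2
    rw [mul_one] at h3
    refine h3.congr_of_eventuallyEq (Eventually.of_forall fun t => ?_)
    simp only [Function.comp]
    congr 1
    module
  -- The criterion by continuous partial derivatives is stated on a product, so `W` is read on `ℝ ×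
  -- ℝ` through `P` and carried back afterwards.
  have main := hasStrictFDerivAt_uncurry_coprod (𝕜 := ℝ) (u := ((0 : ℝ), (0 : ℝ)))
    (f := fun a b => W (x + a • e₀ + b • e₁))
    (f₁ := fun a b => ContinuousLinearMap.toSpanSingleton ℝ (D₀ (x + a • e₀ + b • e₁)))
    (f₂ := fun a b => ContinuousLinearMap.toSpanSingleton ℝ (D₁ (x + a • e₀ + b • e₁)))
    (by
      filter_upwards [hPc.eventually h₀] with v hv
      refine HasDerivAt.hasFDerivAt ?_
      have := shift (D₀ (P v)) (x + v.2 • e₁) e₀ v.1 (by rwa [add_right_comm x])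
      simpa only [add_right_comm x (v.2 • e₁)] using this)
    (by
      filter_upwards [hPc.eventually h₁] with v hv
      exact (shift (D₁ (P v)) (x + v.1 • e₀) e₁ v.2 hv).hasFDerivAt)
    (by
      have : ContinuousAt (fun v => D₀ (P v)) (0, 0) :=
        ContinuousAt.comp (by rw [hP0]; exact c₀) (by simpa [ContinuousAt, hP0] using hPc)
      exact (ContinuousLinearMap.toSpanSingletonCLE (𝕜 := ℝ) (E := ℝ)).continuous.continuousAt.comp
        this)
    (by
      have : ContinuousAt (fun v => D₁ (P v)) (0, 0) :=
        ContinuousAt.comp (by rw [hP0]; exact c₁) (by simpa [ContinuousAt, hP0] using hPc)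
      exact (ContinuousLinearMap.toSpanSingletonCLE (𝕜 := ℝ) (E := ℝ)).continuous.continuousAt.comp
        this)
  have hQ : HasFDerivAt (fun y : Plane => ((y - x) 0, (y - x) 1))
      ((EuclideanSpace.proj 0 : Plane →L[ℝ] ℝ).prod (EuclideanSpace.proj 1 : Plane →L[ℝ] ℝ)) x :=
    ((EuclideanSpace.proj 0 : Plane →L[ℝ] ℝ).prod
      (EuclideanSpace.proj 1 : Plane →L[ℝ] ℝ)).hasFDerivAt.comp x ((hasFDerivAt_id x).sub_const x)
  have hcomp := HasFDerivAt.comp x (g := ↿(fun (a b : ℝ) => W (x + a • e₀ + b • e₁)))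
    (by simpa using main.hasFDerivAt) hQ
  have hfun : (↿(fun (a b : ℝ) => W (x + a • e₀ + b • e₁)) ∘ fun y : Plane => ((y - x) 0, (y - x) 1)) =
      W := by
    funext y
    change W (x + (y - x) 0 • e₀ + (y - x) 1 • e₁) = W y
    congr 1
    ext i
    fin_cases i <;> simp [e₀, e₁]
  rw [hfun] at hcomp
  refine hcomp.congr_fderiv ?_
  ext v
  simp [Function.HasUncurry.uncurry, mul_comm]

/-- A `C¹` one-form `f₀ dx₀ + f₁ dx₁` with `C¹` symmetrized derivative has a differentiable curl. -/
lemma hasFDerivAt_curl {f₀ f₁ s₀₀ s₀₁ s₁₁ : Plane → ℝ} {x : Plane}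
    (hf₀ : ContDiffAt ℝ 1 f₀ x) (hf₁ : ContDiffAt ℝ 1 f₁ x)
    (h₀₀ : ContDiffAt ℝ 1 s₀₀ x) (h₀₁ : ContDiffAt ℝ 1 s₀₁ x) (h₁₁ : ContDiffAt ℝ 1 s₁₁ x)
    (e₀₀ : ∀ᶠ y in 𝓝 x, fderiv ℝ f₀ y (EuclideanSpace.single 0 1) = s₀₀ y)
    (e₀₁ : ∀ᶠ y in 𝓝 x, fderiv ℝ f₁ y (EuclideanSpace.single 0 1)
      + fderiv ℝ f₀ y (EuclideanSpace.single 1 1) = s₀₁ y)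
    (e₁₁ : ∀ᶠ y in 𝓝 x, fderiv ℝ f₁ y (EuclideanSpace.single 1 1) = s₁₁ y) :
    HasFDerivAt (fun y => fderiv ℝ f₁ y (EuclideanSpace.single 0 1)
        - fderiv ℝ f₀ y (EuclideanSpace.single 1 1))
      ((fderiv ℝ s₀₁ x (EuclideanSpace.single 0 1) - 2 * fderiv ℝ s₀₀ x (EuclideanSpace.single 1 1))
          • EuclideanSpace.proj 0 +
        (2 * fderiv ℝ s₁₁ x (EuclideanSpace.single 0 1) - fderiv ℝ s₀₁ x (EuclideanSpace.single 1 1))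
          • EuclideanSpace.proj 1 : Plane →L[ℝ] ℝ) x := by
  have ev : ∀ {f : Plane → ℝ}, ContDiffAt ℝ 1 f x → ∀ᶠ y in 𝓝 x, ContDiffAt ℝ 1 f y :=
    fun h => h.eventually (by simp)
  have cont : ∀ {f : Plane → ℝ} (v : Plane), ContDiffAt ℝ 1 f x →
      ContinuousAt (fun y => fderiv ℝ f y v) x :=
    fun v h => (h.continuousAt_fderiv (by simp)).clm_apply continuousAt_const
  have line : ∀ {f : Plane → ℝ} {y : Plane} (v : Plane), ContDiffAt ℝ 1 f y →
      HasDerivAt (fun t : ℝ => f (y + t • v)) (fderiv ℝ f y v) 0 := by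
    intro f y v h
    have h1 : HasDerivAt (fun t : ℝ => y + t • v) v 0 := by
      simpa using ((hasDerivAt_id (0 : ℝ)).smul_const v).const_add y
    exact HasFDerivAt.comp_hasDerivAt (0 : ℝ)
      (by simpa using (h.differentiableAt (by simp)).hasFDerivAt) h1
  have tend : ∀ (y v : Plane), Tendsto (fun t : ℝ => y + t • v) (𝓝 0) (𝓝 y) := by
    intro y v
    have : Continuous (fun t : ℝ => y + t • v) := by fun_prop
    simpa using this.tendsto 0
  refine hasFDerivAt_of_partial ?_ ?_ ((cont _ h₀₁).sub ((cont _ h₀₀).const_mul 2))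
    (((cont _ h₁₁).const_mul 2).sub (cont _ h₀₁))
  -- Along the first axis the curl is rewritten as `s₀₁ - 2 ∂₁f₀`, and `∂₀∂₁f₀ = ∂₁s₀₀` by the Peano
  -- lemma. Along the second axis it is `2 ∂₀f₁ - s₀₁`, with `∂₁∂₀f₁ = ∂₀s₁₁`.
  · filter_upwards [ev hf₀, ev h₀₀, ev h₀₁, e₀₀.eventually_nhds, e₀₁.eventually_nhds] with
      y hy0 hy00 hy01 he0 he1
    have h1 := hasDerivAt_fderiv_of_hasStrictFDerivAt (EuclideanSpace.single 1 1)
      (EuclideanSpace.single 0 1) ((hy0.eventually (by simp)).mono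
        fun z hz => hz.differentiableAt (by simp)) he0 (hy00.hasStrictFDerivAt (by simp))
    refine ((line (EuclideanSpace.single 0 1) hy01).sub (h1.const_mul 2)).congr_of_eventuallyEq ?_
    filter_upwards [(tend y (EuclideanSpace.single 0 1)).eventually he1] with t ht
    simp only [Pi.sub_apply, ← ht]
    ring
  · filter_upwards [ev hf₁, ev h₁₁, ev h₀₁, e₁₁.eventually_nhds, e₀₁.eventually_nhds] with
      y hy0 hy00 hy01 he0 he1
    have h1 := hasDerivAt_fderiv_of_hasStrictFDerivAt (EuclideanSpace.single 0 1)
      (EuclideanSpace.single 1 1) ((hy0.eventually (by simp)).mono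
        fun z hz => hz.differentiableAt (by simp)) he0 (hy00.hasStrictFDerivAt (by simp))
    refine ((h1.const_mul 2).sub (line (EuclideanSpace.single 1 1) hy01)).congr_of_eventuallyEq ?_
    filter_upwards [(tend y (EuclideanSpace.single 1 1)).eventually he1] with t ht
    simp only [Pi.sub_apply, ← ht]
    ring

end Calculus

/-! ### Rules for one-sided partial derivatives. -/

section PartialD

variable {H : Type*} [TopologicalSpace H] {I : ModelWithCorners ℝ Plane H}
variable {f h : Plane → ℝ} {x : Plane} (i : Fin 2)

lemma partialD_of_hasFDerivWithinAt {f' : Plane →L[ℝ] ℝ} (hx : x ∈ range I)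
    (hf : HasFDerivWithinAt f f' (range I) x) :
    partialD I i f x = f' (EuclideanSpace.single i 1) := by
  rw [partialD, hf.fderivWithin (I.uniqueDiffOn x hx)]

lemma partialD_add (hx : x ∈ range I) (hf : DifferentiableWithinAt ℝ f (range I) x)
    (hh : DifferentiableWithinAt ℝ h (range I) x) :
    partialD I i (fun y => f y + h y) x = partialD I i f x + partialD I i h x := by
  exact partialD_of_hasFDerivWithinAt i hx (hf.hasFDerivWithinAt.add hh.hasFDerivWithinAt)

lemma partialD_sub (hx : x ∈ range I) (hf : DifferentiableWithinAt ℝ f (range I) x)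
    (hh : DifferentiableWithinAt ℝ h (range I) x) :
    partialD I i (fun y => f y - h y) x = partialD I i f x - partialD I i h x := by
  exact partialD_of_hasFDerivWithinAt i hx (hf.hasFDerivWithinAt.sub hh.hasFDerivWithinAt)

lemma partialD_mul (hx : x ∈ range I) (hf : DifferentiableWithinAt ℝ f (range I) x)
    (hh : DifferentiableWithinAt ℝ h (range I) x) :
    partialD I i (fun y => f y * h y) x = f x * partialD I i h x + h x * partialD I i f x := by
  exact partialD_of_hasFDerivWithinAt i hx (hf.hasFDerivWithinAt.mul hh.hasFDerivWithinAt)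

lemma partialD_const_mul (c : ℝ) (hx : x ∈ range I)
    (hf : DifferentiableWithinAt ℝ f (range I) x) :
    partialD I i (fun y => c * f y) x = c * partialD I i f x := by
  rw [partialD_of_hasFDerivWithinAt i hx (hf.hasFDerivWithinAt.const_mul c)]
  rfl

lemma partialD_congr (hfh : ∀ᶠ y in 𝓝[range I] x, f y = h y) (hx : x ∈ range I) :
    partialD I i f x = partialD I i h x := by
  rw [partialD, partialD, Filter.EventuallyEq.fderivWithin_eq hfh (hfh.self_of_nhdsWithin hx)]

lemma partialD_eq_fderiv (hx : x ∈ interior (range I)) :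
    partialD I i f x = fderiv ℝ f x (EuclideanSpace.single i 1) := by
  rw [partialD, fderivWithin_of_mem_nhds (mem_interior_iff_mem_nhds.1 hx)]

lemma eq_smul_single_add (v : Plane) :
    v = v 0 • EuclideanSpace.single 0 (1 : ℝ) + v 1 • EuclideanSpace.single 1 (1 : ℝ) := by
  ext i
  fin_cases i <;> simp

lemma fderivWithin_apply_eq_partialD (v : Plane) :
    fderivWithin ℝ f (range I) x v = v 0 * partialD I 0 f x + v 1 * partialD I 1 f x := by
  conv_lhs => rw [eq_smul_single_add v]
  simp only [map_add, map_smul, smul_eq_mul, partialD]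

lemma _root_.ContDiffWithinAt.partialD {m n : WithTop ℕ∞} (hf : ContDiffWithinAt ℝ n f (range I) x)
    (hmn : m + 1 ≤ n) (hx : x ∈ range I) :
    ContDiffWithinAt ℝ m (Surf.partialD I i f) (range I) x :=
  hf.fderivWithin_right_apply contDiffWithinAt_const I.uniqueDiffOn hmn hx

/-- Symmetry persists at boundary points because the model set lies in the closure of its interior.
-/
lemma partialD_comm (hf : ContDiffWithinAt ℝ 2 f (range I) x) (hx : x ∈ range I) (j : Fin 2) :
    partialD I i (partialD I j f) x = partialD I j (partialD I i f) x := by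
  have hsymm : IsSymmSndFDerivWithinAt ℝ f (range I) x :=
    hf.isSymmSndFDerivWithinAt (by simp) I.uniqueDiffOn (I.range_subset_closure_interior hx) hx
  have hd : DifferentiableWithinAt ℝ (fderivWithin ℝ f (range I)) (range I) x :=
    (hf.fderivWithin_right (m := 1) I.uniqueDiffOn (by norm_num) hx).differentiableWithinAt
      (by simp)
  have key : ∀ a b : Fin 2, partialD I a (partialD I b f) x =
      fderivWithin ℝ (fderivWithin ℝ f (range I)) (range I) x (EuclideanSpace.single a 1)
        (EuclideanSpace.single b 1) := by
    intro a b
    refine (partialD_of_hasFDerivWithinAt a hx (hd.hasFDerivWithinAt.clm_apply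
      (hasFDerivWithinAt_const (EuclideanSpace.single b (1 : ℝ)) x _))).trans ?_
    simp
  rw [key, key, hsymm.eq]

/-- The chain rule for partial derivatives, for a map of the model set to itself. -/
lemma partialD_comp {φ : Plane → Plane} (hx : x ∈ range I)
    (hφ : DifferentiableWithinAt ℝ φ (range I) x) (hmaps : ∀ᶠ y in 𝓝[range I] x, φ y ∈ range I)
    (hf : DifferentiableWithinAt ℝ f (range I) (φ x)) :
    partialD I i (fun y => f (φ y)) x = partialD I i (fun y => φ y 0) x * partialD I 0 f (φ x)
      + partialD I i (fun y => φ y 1) x * partialD I 1 f (φ x) := by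
  have h0 : ∀ a : Fin 2, partialD I i (fun y => φ y a) x =
      fderivWithin ℝ φ (range I) x (EuclideanSpace.single i 1) a := by
    intro a
    exact partialD_of_hasFDerivWithinAt i hx
      ((EuclideanSpace.proj (𝕜 := ℝ) a).hasFDerivAt.comp_hasFDerivWithinAt x hφ.hasFDerivWithinAt)
  have h1 : HasFDerivWithinAt (fun y => f (φ y))
      ((fderivWithin ℝ f (range I) (φ x)).comp (fderivWithin ℝ φ (range I) x)) (range I) x := by
    have hm : range I ∩ φ ⁻¹' range I ∈ 𝓝[range I] x :=
      inter_mem self_mem_nhdsWithin hmaps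
    exact (hf.hasFDerivWithinAt.comp x (hφ.hasFDerivWithinAt.mono inter_subset_left)
      (fun y hy => hy.2)).mono_of_mem_nhdsWithin hm
  rw [partialD_of_hasFDerivWithinAt i hx h1, ContinuousLinearMap.comp_apply,
    fderivWithin_apply_eq_partialD, h0, h0]

end PartialD

/-! ### Metric coefficients and Christoffel symbols. -/

section MetricChart

variable {H : Type*} [TopologicalSpace H] {I : ModelWithCorners ℝ Plane H}
variable {M : Type*} [TopologicalSpace M] [ChartedSpace H M] [IsManifold I ∞ M]
variable (g : Metric I M) {e : OpenPartialHomeomorph M H} {x : Plane}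

lemma metricCoeff_symm (e : OpenPartialHomeomorph M H) (i j : Fin 2) (x : Plane) :
    metricCoeff g e i j x = metricCoeff g e j i x :=
  g.symm _ _ _

/-- The Gram–Schmidt vector `z = g(v,v) w - g(v,w) v` is nonzero, and `g(z,z)` is `g(v,v)` times the
Gram determinant. -/
lemma gram_pos (p : M) {v w : TangentSpace I p} (h : LinearIndependent ℝ ![v, w]) :
    0 < g.inner p v v * g.inner p w w - g.inner p v w ^ 2 := by
  have hv : v ≠ 0 := h.ne_zero 0
  have hvv := g.pos p v hv
  have hz : g.inner p v v • w - g.inner p v w • v ≠ 0 := by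
    intro h0
    have := LinearIndependent.pair_iff.1 h (-g.inner p v w) (g.inner p v v) (by
      rw [neg_smul, neg_add_eq_sub]; exact h0)
    exact hvv.ne' this.2
  have hp := g.pos p _ hz
  have hs := g.symm p w v
  simp only [map_sub, map_smul, _root_.sub_apply, _root_.smul_apply,
    smul_eq_mul, hs] at hp
  have hp' : 0 < g.inner p v v * (g.inner p v v * g.inner p w w - g.inner p v w ^ 2) := by
    linarith
  exact (pos_iff_pos_of_mul_pos hp').1 hvv

lemma det_metricMatrix (e : OpenPartialHomeomorph M H) (x : Plane) :
    (metricMatrix g e x).det =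
      metricCoeff g e 0 0 x * metricCoeff g e 1 1 x - metricCoeff g e 0 1 x ^ 2 := by
  rw [Matrix.det_fin_two]
  simp only [metricMatrix, Matrix.of_apply, metricCoeff_symm g e 1 0]
  ring

lemma det_metricMatrix_pos (he : e ∈ atlas H M) (hx : x ∈ (e.extend I).target) :
    0 < (metricMatrix g e x).det := by
  rw [det_metricMatrix]
  exact gram_pos g _ (linearIndependent_coordVec he hx)

lemma flatCoeff_eq (he : e ∈ atlas H M) (X : ∀ p : M, TangentSpace I p) (i : Fin 2)
    (hx : x ∈ (e.extend I).target) :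
    flatCoeff g X e i x = metricCoeff g e 0 i x * vecCoeff I e X 0 x
      + metricCoeff g e 1 i x * vecCoeff I e X 1 x := by
  rw [flatCoeff, eq_sum_vecCoeff_smul he X hx]
  simp only [map_add, map_smul, _root_.add_apply, _root_.smul_apply,
    smul_eq_mul, metricCoeff]
  ring

lemma contDiffWithinAt_flatCoeff {X : ∀ p : M, TangentSpace I p}
    (hX : ContMDiff I I.tangent 1 (fun p : M => (⟨p, X p⟩ : TangentBundle I M)))
    (he : e ∈ atlas H M) (i : Fin 2) (hx : x ∈ (e.extend I).target) :
    ContDiffWithinAt ℝ 1 (flatCoeff g X e i) (range I) x := by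
  have hG : ∀ a, ContDiffWithinAt ℝ 1 (metricCoeff g e a i) (range I) x := fun a =>
    (contDiffWithinAt_metricCoeff g he a i hx).of_le (by simp)
  refine (((hG 0).mul (contDiffWithinAt_vecCoeff hX he 0 hx)).add
    ((hG 1).mul (contDiffWithinAt_vecCoeff hX he 1 hx))).congr_of_eventuallyEq ?_ ?_
  · filter_upwards [extend_target_mem_nhdsWithin_range e hx] with y hy
    exact flatCoeff_eq g he X i hy
  · exact flatCoeff_eq g he X i hx

lemma christoffel_symm (e : OpenPartialHomeomorph M H) (k i j : Fin 2) (x : Plane) :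
    christoffel g e k i j x = christoffel g e k j i x := by
  have h : metricCoeff g e i j = metricCoeff g e j i := funext (metricCoeff_symm g e i j)
  simp only [christoffel, h, add_comm (partialD I i _ x)]

/-- Lowering the upper index cancels the inverse metric and leaves Christoffel symbols of the first
kind. -/
lemma sum_metricCoeff_mul_christoffel (he : e ∈ atlas H M) (hx : x ∈ (e.extend I).target)
    (k i j : Fin 2) :
    metricCoeff g e k 0 x * christoffel g e 0 i j x + metricCoeff g e k 1 x * christoffel g e 1 i j x
      = (1 / 2) * (partialD I i (metricCoeff g e j k) x + partialD I j (metricCoeff g e i k) x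
        - partialD I k (metricCoeff g e i j) x) := by
  have hdet : IsUnit (metricMatrix g e x).det := (det_metricMatrix_pos g he hx).ne'.isUnit
  have h := Matrix.mul_nonsing_inv _ hdet
  have hk : ∀ l, metricCoeff g e k 0 x * (metricMatrix g e x)⁻¹ 0 l
      + metricCoeff g e k 1 x * (metricMatrix g e x)⁻¹ 1 l = if k = l then 1 else 0 := by
    intro l
    have := congrFun (congrFun h k) l
    rw [Matrix.mul_apply, Fin.sum_univ_two, Matrix.one_apply] at this
    exact this
  simp only [christoffel, Fin.sum_univ_two]
  have hk0 := hk 0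
  have hk1 := hk 1
  fin_cases k
  · simp only [Fin.zero_eta, Fin.isValue, reduceIte, zero_ne_one] at hk0 hk1 ⊢
    linear_combination (1 / 2) * (partialD I i (metricCoeff g e j 0) x
      + partialD I j (metricCoeff g e i 0) x - partialD I 0 (metricCoeff g e i j) x) * hk0
      + (1 / 2) * (partialD I i (metricCoeff g e j 1) x
      + partialD I j (metricCoeff g e i 1) x - partialD I 1 (metricCoeff g e i j) x) * hk1
  · simp only [Fin.mk_one, Fin.isValue, reduceIte, one_ne_zero] at hk0 hk1 ⊢
    linear_combination (1 / 2) * (partialD I i (metricCoeff g e j 0) x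
      + partialD I j (metricCoeff g e i 0) x - partialD I 0 (metricCoeff g e i j) x) * hk0
      + (1 / 2) * (partialD I i (metricCoeff g e j 1) x
      + partialD I j (metricCoeff g e i 1) x - partialD I 1 (metricCoeff g e i j) x) * hk1

/-- The Levi-Civita connection is metric. -/
lemma partialD_metricCoeff (he : e ∈ atlas H M) (hx : x ∈ (e.extend I).target) (i j k : Fin 2) :
    partialD I i (metricCoeff g e j k) x =
      metricCoeff g e 0 k x * christoffel g e 0 i j x
        + metricCoeff g e 1 k x * christoffel g e 1 i j x
        + (metricCoeff g e 0 j x * christoffel g e 0 i k x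
          + metricCoeff g e 1 j x * christoffel g e 1 i k x) := by
  have h1 := sum_metricCoeff_mul_christoffel g he hx k i j
  have h2 := sum_metricCoeff_mul_christoffel g he hx j i k
  have hs : ∀ a b, metricCoeff g e a b = metricCoeff g e b a :=
    fun a b => funext (metricCoeff_symm g e a b)
  rw [hs 0 k, hs 1 k, hs 0 j, hs 1 j, h1, h2, hs k j]
  ring

lemma contDiffWithinAt_christoffel (he : e ∈ atlas H M) (hx : x ∈ (e.extend I).target)
    (k i j : Fin 2) : ContDiffWithinAt ℝ ∞ (christoffel g e k i j) (range I) x := by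
  have hG : ∀ a b, ContDiffWithinAt ℝ ∞ (metricCoeff g e a b) (range I) x := fun a b =>
    contDiffWithinAt_metricCoeff g he a b hx
  have hdG : ∀ c a b, ContDiffWithinAt ℝ ∞ (partialD I c (metricCoeff g e a b)) (range I) x :=
    fun c a b => (hG a b).partialD c (by simp) (mem_range_of_mem_target hx)
  have hdet : ContDiffWithinAt ℝ ∞ (fun y => (metricMatrix g e y).det) (range I) x := by
    simp only [det_metricMatrix]
    exact ((hG 0 0).mul (hG 1 1)).sub ((hG 0 1).pow 2)
  -- Cramer's rule: the inverse is the adjugate divided by a determinant that does not vanish.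
  have hinv : ∀ a b, ContDiffWithinAt ℝ ∞ (fun y => (metricMatrix g e y)⁻¹ a b) (range I) x := by
    intro a b
    have hadj : ContDiffWithinAt ℝ ∞ (fun y => (metricMatrix g e y).adjugate a b) (range I) x := by
      simp only [Matrix.adjugate_fin_two, metricMatrix, Matrix.of_apply]
      fin_cases a <;> fin_cases b <;> simp [hG, ContDiffWithinAt.neg]
    have hd' := hdet.inv (det_metricMatrix_pos g he hx).ne'
    simpa only [Matrix.inv_def, Ring.inverse_eq_inv', Matrix.smul_apply, smul_eq_mul] using!
      hd'.mul hadj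
  unfold christoffel
  refine contDiffWithinAt_const.mul (ContDiffWithinAt.sum fun l _ => ?_)
  exact (hinv k l).mul (((hdG i j l).add (hdG j i l)).sub (hdG l i j))

end MetricChart

/-! ### Symmetries of the curvature tensor. -/

section Curvature

variable {H : Type*} [TopologicalSpace H] {I : ModelWithCorners ℝ Plane H}
variable {M : Type*} [TopologicalSpace M] [ChartedSpace H M] [IsManifold I ∞ M]
variable (g : Metric I M) {e : OpenPartialHomeomorph M H} {x : Plane}

/-- The component `Qˡ` of the curvature vector `R(∂₀, ∂₁) ∂₀ = Qˡ ∂ₗ` in the chart `e`. -/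
noncomputable def riemannCoeffZero (e : OpenPartialHomeomorph M H) (l : Fin 2) (x : Plane) : ℝ :=
  partialD I 0 (christoffel g e l 0 1) x - partialD I 1 (christoffel g e l 0 0) x
    + ∑ m, (christoffel g e l 0 m x * christoffel g e m 0 1 x
      - christoffel g e l 1 m x * christoffel g e m 0 0 x)

/-- The product `g(R(∂₀, ∂₁) ∂₁, ∂₀)`, the numerator of the Gaussian curvature in the chart `e`. -/
noncomputable def curvatureNum (e : OpenPartialHomeomorph M H) (x : Plane) : ℝ :=
  ∑ l, metricCoeff g e 0 l x * riemannCoeff g e l x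

lemma partialD_partialD_metricCoeff (he : e ∈ atlas H M) (hx : x ∈ (e.extend I).target)
    (m i j k : Fin 2) :
    partialD I m (partialD I i (metricCoeff g e j k)) x =
      (metricCoeff g e 0 k x * partialD I m (christoffel g e 0 i j) x
        + christoffel g e 0 i j x * partialD I m (metricCoeff g e 0 k) x)
      + (metricCoeff g e 1 k x * partialD I m (christoffel g e 1 i j) x
        + christoffel g e 1 i j x * partialD I m (metricCoeff g e 1 k) x)
      + ((metricCoeff g e 0 j x * partialD I m (christoffel g e 0 i k) x
        + christoffel g e 0 i k x * partialD I m (metricCoeff g e 0 j) x)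
      + (metricCoeff g e 1 j x * partialD I m (christoffel g e 1 i k) x
        + christoffel g e 1 i k x * partialD I m (metricCoeff g e 1 j) x)) := by
  have hr := mem_range_of_mem_target hx
  have hG : ∀ a b, DifferentiableWithinAt ℝ (metricCoeff g e a b) (range I) x := fun a b =>
    (contDiffWithinAt_metricCoeff g he a b hx).differentiableWithinAt (by simp)
  have hC : ∀ a b c, DifferentiableWithinAt ℝ (christoffel g e a b c) (range I) x := fun a b c =>
    (contDiffWithinAt_christoffel g he hx a b c).differentiableWithinAt (by simp)
  rw [partialD_congr (h := fun y => metricCoeff g e 0 k y * christoffel g e 0 i j y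
        + metricCoeff g e 1 k y * christoffel g e 1 i j y
        + (metricCoeff g e 0 j y * christoffel g e 0 i k y
          + metricCoeff g e 1 j y * christoffel g e 1 i k y)) m
    (by filter_upwards [extend_target_mem_nhdsWithin_range e hx] with y hy
        exact partialD_metricCoeff g he hy i j k) hr]
  rw [partialD_add m hr (((hG _ _).fun_mul (hC _ _ _)).fun_add ((hG _ _).fun_mul (hC _ _ _)))
    (((hG _ _).fun_mul (hC _ _ _)).fun_add ((hG _ _).fun_mul (hC _ _ _))),
    partialD_add m hr ((hG _ _).fun_mul (hC _ _ _)) ((hG _ _).fun_mul (hC _ _ _)),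
    partialD_add m hr ((hG _ _).fun_mul (hC _ _ _)) ((hG _ _).fun_mul (hC _ _ _)),
    partialD_mul m hr (hG _ _) (hC _ _ _), partialD_mul m hr (hG _ _) (hC _ _ _),
    partialD_mul m hr (hG _ _) (hC _ _ _), partialD_mul m hr (hG _ _) (hC _ _ _)]

lemma partialD_partialD_metricCoeff_comm (he : e ∈ atlas H M) (hx : x ∈ (e.extend I).target)
    (j k : Fin 2) :
    partialD I 0 (partialD I 1 (metricCoeff g e j k)) x =
      partialD I 1 (partialD I 0 (metricCoeff g e j k)) x :=
  partialD_comm 0 ((contDiffWithinAt_metricCoeff g he j k hx).of_le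
    (WithTop.coe_le_coe.2 le_top)) (mem_range_of_mem_target hx) 1

/-- `g(R(∂₀,∂₁)∂₁, ∂₁) = 0` comes from equating `∂₀∂₁g₁₁` and `∂₁∂₀g₁₁`, both expanded twice by
metric compatibility. The next two lemmas do the same with `g₀₀` and `g₀₁`; together they express
antisymmetry of the curvature operator. -/
lemma inner_riemannCoeff_one (he : e ∈ atlas H M) (hx : x ∈ (e.extend I).target) :
    metricCoeff g e 0 1 x * riemannCoeff g e 0 x + metricCoeff g e 1 1 x * riemannCoeff g e 1 x
      = 0 := by
  have h := partialD_partialD_metricCoeff_comm g he hx 1 1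
  simp only [partialD_partialD_metricCoeff g he hx, partialD_metricCoeff g he hx] at h
  simp only [riemannCoeff, Fin.sum_univ_two]
  have hs : ∀ k, christoffel g e k 1 0 = christoffel g e k 0 1 :=
    fun k => funext (christoffel_symm g e k 1 0)
  simp only [hs, metricCoeff_symm g e 1 0] at h ⊢
  linear_combination (1 / 2) * h

lemma inner_riemannCoeffZero_zero (he : e ∈ atlas H M) (hx : x ∈ (e.extend I).target) :
    metricCoeff g e 0 0 x * riemannCoeffZero g e 0 x
      + metricCoeff g e 0 1 x * riemannCoeffZero g e 1 x = 0 := by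
  have h := partialD_partialD_metricCoeff_comm g he hx 0 0
  simp only [partialD_partialD_metricCoeff g he hx, partialD_metricCoeff g he hx] at h
  simp only [riemannCoeffZero, Fin.sum_univ_two]
  have hs : ∀ k, christoffel g e k 1 0 = christoffel g e k 0 1 :=
    fun k => funext (christoffel_symm g e k 1 0)
  simp only [hs, metricCoeff_symm g e 1 0] at h ⊢
  linear_combination (1 / 2) * h

lemma inner_riemannCoeffZero_one (he : e ∈ atlas H M) (hx : x ∈ (e.extend I).target) :
    metricCoeff g e 0 1 x * riemannCoeffZero g e 0 x
      + metricCoeff g e 1 1 x * riemannCoeffZero g e 1 x = -curvatureNum g e x := by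
  have h := partialD_partialD_metricCoeff_comm g he hx 0 1
  simp only [partialD_partialD_metricCoeff g he hx, partialD_metricCoeff g he hx] at h
  simp only [riemannCoeffZero, riemannCoeff, curvatureNum, Fin.sum_univ_two]
  have hs : ∀ k, christoffel g e k 1 0 = christoffel g e k 0 1 :=
    fun k => funext (christoffel_symm g e k 1 0)
  simp only [hs, metricCoeff_symm g e 1 0] at h ⊢
  linear_combination h

/-- Makes nonvanishing of the curvature an open condition. -/
lemma continuousWithinAt_curvatureNum (he : e ∈ atlas H M) (hx : x ∈ (e.extend I).target) :
    ContinuousWithinAt (curvatureNum g e) (range I) x := by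
  have hr := mem_range_of_mem_target hx
  have hG : ∀ a b, ContinuousWithinAt (metricCoeff g e a b) (range I) x := fun a b =>
    (contDiffWithinAt_metricCoeff g he a b hx).continuousWithinAt
  have hC : ∀ a b c, ContinuousWithinAt (christoffel g e a b c) (range I) x := fun a b c =>
    (contDiffWithinAt_christoffel g he hx a b c).continuousWithinAt
  have hD : ∀ m a b c, ContinuousWithinAt (partialD I m (christoffel g e a b c)) (range I) x :=
    fun m a b c => ((contDiffWithinAt_christoffel g he hx a b c).partialD (m := ∞) m (by simp)
      hr).continuousWithinAt
  unfold curvatureNum riemannCoeff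
  simp only [Fin.sum_univ_two]
  exact ((hG _ _).mul (((hD _ _ _ _).sub (hD _ _ _ _)).add
    ((((hC _ _ _).mul (hC _ _ _)).sub ((hC _ _ _).mul (hC _ _ _))).add
      (((hC _ _ _).mul (hC _ _ _)).sub ((hC _ _ _).mul (hC _ _ _)))))).add
    ((hG _ _).mul (((hD _ _ _ _).sub (hD _ _ _ _)).add
    ((((hC _ _ _).mul (hC _ _ _)).sub ((hC _ _ _).mul (hC _ _ _))).add
      (((hC _ _ _).mul (hC _ _ _)).sub ((hC _ _ _).mul (hC _ _ _))))))

/-- Jacobi's formula; its Christoffel trace is the one that appears in the derivative of the curl.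
-/
lemma partialD_det_metricMatrix (he : e ∈ atlas H M) (hx : x ∈ (e.extend I).target) (i : Fin 2) :
    partialD I i (fun y => (metricMatrix g e y).det) x =
      2 * (metricMatrix g e x).det * (christoffel g e 0 i 0 x + christoffel g e 1 i 1 x) := by
  have hr := mem_range_of_mem_target hx
  have hG : ∀ a b, DifferentiableWithinAt ℝ (metricCoeff g e a b) (range I) x := fun a b =>
    (contDiffWithinAt_metricCoeff g he a b hx).differentiableWithinAt (by simp)
  simp only [det_metricMatrix, pow_two]
  rw [partialD_sub i hr ((hG _ _).fun_mul (hG _ _)) ((hG _ _).fun_mul (hG _ _)),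
    partialD_mul i hr (hG _ _) (hG _ _), partialD_mul i hr (hG _ _) (hG _ _)]
  simp only [partialD_metricCoeff g he hx, metricCoeff_symm g e 1 0]
  ring

end Curvature

/-! ### The derivative of the vorticity of a Killing field. -/

section Killing

variable {H : Type*} [TopologicalSpace H] {I : ModelWithCorners ℝ Plane H}
variable {M : Type*} [TopologicalSpace M] [ChartedSpace H M] [IsManifold I ∞ M]
variable (g : Metric I M) {e : OpenPartialHomeomorph M H} {x : Plane}
variable {X : ∀ p : M, TangentSpace I p}

/-- The component `∂₀ v₁ - ∂₁ v₀` of `d v♭` in the chart `e`. -/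
noncomputable def curl (X : ∀ p : M, TangentSpace I p) (e : OpenPartialHomeomorph M H)
    (x : Plane) : ℝ :=
  partialD I 0 (flatCoeff g X e 1) x - partialD I 1 (flatCoeff g X e 0) x

lemma partialD_flatCoeff (he : e ∈ atlas H M) (hx : x ∈ (e.extend I).target)
    (hX : ContMDiff I I.tangent 1 (fun p : M => (⟨p, X p⟩ : TangentBundle I M))) (i j : Fin 2) :
    partialD I i (flatCoeff g X e j) x =
      metricCoeff g e 0 j x * partialD I i (vecCoeff I e X 0) x
        + vecCoeff I e X 0 x * partialD I i (metricCoeff g e 0 j) x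
      + (metricCoeff g e 1 j x * partialD I i (vecCoeff I e X 1) x
        + vecCoeff I e X 1 x * partialD I i (metricCoeff g e 1 j) x) := by
  have hr := mem_range_of_mem_target hx
  have hG : ∀ a b, DifferentiableWithinAt ℝ (metricCoeff g e a b) (range I) x := fun a b =>
    (contDiffWithinAt_metricCoeff g he a b hx).differentiableWithinAt (by simp)
  have hV : ∀ a, DifferentiableWithinAt ℝ (vecCoeff I e X a) (range I) x := fun a =>
    (contDiffWithinAt_vecCoeff hX he a hx).differentiableWithinAt (by simp)
  rw [partialD_congr (h := fun y => metricCoeff g e 0 j y * vecCoeff I e X 0 y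
      + metricCoeff g e 1 j y * vecCoeff I e X 1 y) i
    (by filter_upwards [extend_target_mem_nhdsWithin_range e hx] with y hy
        exact flatCoeff_eq g he X j hy) hr,
    partialD_add i hr ((hG _ _).fun_mul (hV _)) ((hG _ _).fun_mul (hV _)),
    partialD_mul i hr (hG _ _) (hV _), partialD_mul i hr (hG _ _) (hV _)]

/-- The Killing equation for the velocity form: `∂ᵢ Xⱼ + ∂ⱼ Xᵢ = 2 Γᵐᵢⱼ Xₘ`. -/
lemma IsHydrodynamicKilling.partialD_flatCoeff_add (hX : IsHydrodynamicKilling g X)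
    (he : e ∈ atlas H M) (hx : x ∈ (e.extend I).target) (i j : Fin 2) :
    partialD I i (flatCoeff g X e j) x + partialD I j (flatCoeff g X e i) x =
      2 * (christoffel g e 0 i j x * flatCoeff g X e 0 x
        + christoffel g e 1 i j x * flatCoeff g X e 1 x) := by
  have hL := hX.lieDeriv_eq_zero e he x hx i j
  simp only [lieDerivMetric, Fin.sum_univ_two] at hL
  rw [partialD_flatCoeff g he hx hX.contMDiff, partialD_flatCoeff g he hx hX.contMDiff,
    flatCoeff_eq g he X 0 hx, flatCoeff_eq g he X 1 hx]
  have hs : ∀ a b, metricCoeff g e a b = metricCoeff g e b a :=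
    fun a b => funext (metricCoeff_symm g e a b)
  have h0 := sum_metricCoeff_mul_christoffel g he hx 0 i j
  have h1 := sum_metricCoeff_mul_christoffel g he hx 1 i j
  rw [hs i 0, hs i 1] at hL
  rw [hs i 0, hs j 0] at h0
  rw [hs i 1, hs j 1] at h1
  linear_combination hL - 2 * vecCoeff I e X 0 x * h0 - 2 * vecCoeff I e X 1 x * h1

lemma continuousWithinAt_curl
    (hX : ContMDiff I I.tangent 1 (fun p : M => (⟨p, X p⟩ : TangentBundle I M)))
    (he : e ∈ atlas H M) (hx : x ∈ (e.extend I).target) :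
    ContinuousWithinAt (curl g X e) (range I) x := by
  have hr := mem_range_of_mem_target hx
  have hF : ∀ i j, ContinuousWithinAt (partialD I i (flatCoeff g X e j)) (range I) x := fun i j =>
    ((contDiffWithinAt_flatCoeff g hX he j hx).partialD (m := 0) i (by simp) hr).continuousWithinAt
  exact (hF 0 1).sub (hF 1 0)

/-- Apply `Surf.hasFDerivAt_curl` with symmetrized derivatives given by the Killing equation.
Derivatives of the Christoffel symbols, with the quadratic terms, assemble into curvature; the
antisymmetric half of the first derivatives contributes the curl times a Christoffel trace. -/
lemma IsHydrodynamicKilling.hasFDerivAt_curl (hX : IsHydrodynamicKilling g X)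
    (he : e ∈ atlas H M) (hx : x ∈ (e.extend I).target) (hi : x ∈ interior (range I)) :
    HasFDerivAt (curl g X e)
      ((-2 * curvatureNum g e x * vecCoeff I e X 1 x
          + curl g X e x * (christoffel g e 0 0 0 x + christoffel g e 1 0 1 x)) •
          EuclideanSpace.proj 0
        + (2 * curvatureNum g e x * vecCoeff I e X 0 x
          + curl g X e x * (christoffel g e 0 0 1 x + christoffel g e 1 1 1 x)) •
          EuclideanSpace.proj 1 : Plane →L[ℝ] ℝ) x := by
  have hr := mem_range_of_mem_target hx
  have hn : 𝓝[range I] x = 𝓝 x := nhdsWithin_eq_nhds.2 (mem_interior_iff_mem_nhds.1 hi)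
  have hT : ∀ᶠ y in 𝓝 x, y ∈ (e.extend I).target ∧ y ∈ interior (range I) := by
    refine Filter.Eventually.and ?_ (isOpen_interior.mem_nhds hi)
    rw [← hn]
    exact extend_target_mem_nhdsWithin_range e hx
  have hF : ∀ a, ContDiffWithinAt ℝ 1 (flatCoeff g X e a) (range I) x := fun a =>
    contDiffWithinAt_flatCoeff g hX.contMDiff he a hx
  have hC : ∀ a b c, ContDiffWithinAt ℝ 1 (christoffel g e a b c) (range I) x := fun a b c =>
    (contDiffWithinAt_christoffel g he hx a b c).of_le (by simp)
  have at_of : ∀ {f : Plane → ℝ}, ContDiffWithinAt ℝ 1 f (range I) x → ContDiffAt ℝ 1 f x :=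
    fun h => h.contDiffAt (mem_interior_iff_mem_nhds.1 hi)
  set s : Fin 2 → Fin 2 → Plane → ℝ := fun i j y =>
    christoffel g e 0 i j y * flatCoeff g X e 0 y + christoffel g e 1 i j y * flatCoeff g X e 1 y
    with hs
  have hsC : ∀ i j, ContDiffWithinAt ℝ 1 (s i j) (range I) x := fun i j =>
    ((hC 0 i j).mul (hF 0)).add ((hC 1 i j).mul (hF 1))
  have hK : ∀ y, y ∈ (e.extend I).target → ∀ i j, partialD I i (flatCoeff g X e j) y
      + partialD I j (flatCoeff g X e i) y = 2 * s i j y :=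
    fun y hy i j => hX.partialD_flatCoeff_add g he hy i j
  have hps : ∀ m i j, partialD I m (s i j) x =
      christoffel g e 0 i j x * partialD I m (flatCoeff g X e 0) x
      + flatCoeff g X e 0 x * partialD I m (christoffel g e 0 i j) x
      + (christoffel g e 1 i j x * partialD I m (flatCoeff g X e 1) x
      + flatCoeff g X e 1 x * partialD I m (christoffel g e 1 i j) x) := by
    intro m i j
    have dF : ∀ a, DifferentiableWithinAt ℝ (flatCoeff g X e a) (range I) x :=
      fun a => (hF a).differentiableWithinAt (by simp)
    have dC : ∀ a b c, DifferentiableWithinAt ℝ (christoffel g e a b c) (range I) x :=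
      fun a b c => (hC a b c).differentiableWithinAt (by simp)
    rw [hs, partialD_add m hr ((dC _ _ _).fun_mul (dF _)) ((dC _ _ _).fun_mul (dF _)),
      partialD_mul m hr (dC _ _ _) (dF _), partialD_mul m hr (dC _ _ _) (dF _)]
  have main := Surf.hasFDerivAt_curl (s₀₀ := s 0 0) (s₀₁ := fun y => 2 * s 0 1 y) (s₁₁ := s 1 1)
    (at_of (hF 0)) (at_of (hF 1)) (at_of (hsC 0 0))
    (at_of (contDiffWithinAt_const.mul (hsC 0 1))) (at_of (hsC 1 1))
    (by
      filter_upwards [hT] with y hy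
      rw [← partialD_eq_fderiv 0 hy.2]
      linarith [hK y hy.1 0 0])
    (by
      filter_upwards [hT] with y hy
      rw [← partialD_eq_fderiv 0 hy.2, ← partialD_eq_fderiv 1 hy.2]
      linarith [hK y hy.1 0 1])
    (by
      filter_upwards [hT] with y hy
      rw [← partialD_eq_fderiv 1 hy.2]
      linarith [hK y hy.1 1 1])
  have main' : HasFDerivAt (curl g X e) _ x := main.congr_of_eventuallyEq (by
    filter_upwards [hT] with y hy
    rw [curl, partialD_eq_fderiv 0 hy.2, partialD_eq_fderiv 1 hy.2])
  refine main'.congr_fderiv ?_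
  have hs' : ∀ k, christoffel g e k 1 0 = christoffel g e k 0 1 :=
    fun k => funext (christoffel_symm g e k 1 0)
  have f00 := hK x hx 0 0
  have f01 := hK x hx 0 1
  have f11 := hK x hx 1 1
  have hcurl : curl g X e x = partialD I 0 (flatCoeff g X e 1) x
    - partialD I 1 (flatCoeff g X e 0) x := rfl
  have e0 := flatCoeff_eq g he X 0 hx
  have e1 := flatCoeff_eq g he X 1 hx
  -- The Killing equation fixes the symmetric part of `∂ᵢXⱼ`; the antisymmetric part is half the
  -- curl.
  have d00 : partialD I 0 (flatCoeff g X e 0) x = s 0 0 x := by linarith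
  have d11 : partialD I 1 (flatCoeff g X e 1) x = s 1 1 x := by linarith
  have d01 : partialD I 0 (flatCoeff g X e 1) x = s 0 1 x + curl g X e x / 2 := by linarith
  have d10 : partialD I 1 (flatCoeff g X e 0) x = s 0 1 x - curl g X e x / 2 := by linarith
  have r1 := inner_riemannCoeff_one g he hx
  have q0 := inner_riemannCoeffZero_zero g he hx
  have q1 := inner_riemannCoeffZero_one g he hx
  have k0 : curvatureNum g e x = metricCoeff g e 0 0 x * riemannCoeff g e 0 x
      + metricCoeff g e 0 1 x * riemannCoeff g e 1 x := by
    simp [curvatureNum, Fin.sum_univ_two]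
  congr 2
  · rw [← partialD_eq_fderiv 0 hi, ← partialD_eq_fderiv 1 hi,
      partialD_const_mul 0 2 hr ((hsC 0 1).differentiableWithinAt (by simp)), hps, hps,
      d00, d01, d10, d11]
    -- This is `g(R(∂₀,∂₁)∂₀, X)`: by antisymmetry only the component `X¹` survives.
    have hq : riemannCoeffZero g e 0 x * flatCoeff g X e 0 x
        + riemannCoeffZero g e 1 x * flatCoeff g X e 1 x
        = - curvatureNum g e x * vecCoeff I e X 1 x := by
      rw [e0, e1, metricCoeff_symm g e 1 0]
      linear_combination vecCoeff I e X 0 x * q0 + vecCoeff I e X 1 x * q1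
    simp only [riemannCoeffZero, Fin.sum_univ_two, hs'] at hq
    simp only [hs]
    linear_combination 2 * hq
  · rw [← partialD_eq_fderiv 0 hi, ← partialD_eq_fderiv 1 hi,
      partialD_const_mul 1 2 hr ((hsC 0 1).differentiableWithinAt (by simp)), hps, hps,
      d00, d01, d10, d11]
    have hq : riemannCoeff g e 0 x * flatCoeff g X e 0 x
        + riemannCoeff g e 1 x * flatCoeff g X e 1 x
        = curvatureNum g e x * vecCoeff I e X 0 x := by
      rw [e0, e1, k0, metricCoeff_symm g e 1 0]
      linear_combination vecCoeff I e X 1 x * r1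
    simp only [riemannCoeff, Fin.sum_univ_two, hs'] at hq
    simp only [hs]
    linear_combination 2 * hq

/-- The function `ω` in the chart `e`, up to the sign of the coordinate frame. -/
noncomputable def chartVorticity (X : ∀ p : M, TangentSpace I p) (e : OpenPartialHomeomorph M H)
    (x : Plane) : ℝ :=
  curl g X e x / √(metricMatrix g e x).det

lemma continuousWithinAt_chartVorticity
    (hX : ContMDiff I I.tangent 1 (fun p : M => (⟨p, X p⟩ : TangentBundle I M)))
    (he : e ∈ atlas H M) (hx : x ∈ (e.extend I).target) :
    ContinuousWithinAt (chartVorticity g X e) (range I) x := by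
  have hG : ∀ a b, ContinuousWithinAt (metricCoeff g e a b) (range I) x := fun a b =>
    (contDiffWithinAt_metricCoeff g he a b hx).continuousWithinAt
  have hdet : ContinuousWithinAt (fun y => (metricMatrix g e y).det) (range I) x := by
    simp only [det_metricMatrix]
    exact ((hG 0 0).mul (hG 1 1)).sub ((hG 0 1).pow 2)
  exact (continuousWithinAt_curl g hX he hx).div hdet.sqrt
    (Real.sqrt_pos.2 (det_metricMatrix_pos g he hx)).ne'

/-- The derivative of the vorticity of a Killing field: `dω = 2 K ⋆ X♭`, up to sign. -/
lemma IsHydrodynamicKilling.hasFDerivAt_chartVorticity (hX : IsHydrodynamicKilling g X)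
    (he : e ∈ atlas H M) (hx : x ∈ (e.extend I).target) (hi : x ∈ interior (range I)) :
    HasFDerivAt (chartVorticity g X e)
      ((2 * curvatureNum g e x / √(metricMatrix g e x).det) •
        (-vecCoeff I e X 1 x • EuclideanSpace.proj 0
          + vecCoeff I e X 0 x • EuclideanSpace.proj 1) : Plane →L[ℝ] ℝ) x := by
  have hr := mem_range_of_mem_target hx
  have hD := det_metricMatrix_pos g he hx
  have hG : ∀ a b, DifferentiableWithinAt ℝ (metricCoeff g e a b) (range I) x := fun a b =>
    (contDiffWithinAt_metricCoeff g he a b hx).differentiableWithinAt (by simp)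
  have hdet : DifferentiableAt ℝ (fun y => (metricMatrix g e y).det) x := by
    refine DifferentiableWithinAt.differentiableAt (s := range I) ?_
      (mem_interior_iff_mem_nhds.1 hi)
    simp only [det_metricMatrix]
    exact ((hG 0 0).fun_mul (hG 1 1)).fun_sub ((hG 0 1).fun_pow 2)
  have hsq0 : √(metricMatrix g e x).det ≠ 0 := (Real.sqrt_pos.2 hD).ne'
  have hsq := (hasDerivAt_inv hsq0).comp_hasFDerivAt x (hdet.hasFDerivAt.sqrt hD.ne')
  have h := (hX.hasFDerivAt_curl g he hx hi).mul hsq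
  have h' : HasFDerivAt (chartVorticity g X e) _ x := h
  refine h'.congr_fderiv ?_
  have hp := fun i => partialD_det_metricMatrix g he hx i
  simp only [partialD_eq_fderiv _ hi] at hp
  have hs : ∀ k, christoffel g e k 1 0 x = christoffel g e k 0 1 x :=
    fun k => christoffel_symm g e k 1 0 x
  have hss := Real.sq_sqrt hD.le
  ext v
  have hv : fderiv ℝ (fun y => (metricMatrix g e y).det) x v =
      v 0 * (2 * (metricMatrix g e x).det * (christoffel g e 0 0 0 x + christoffel g e 1 0 1 x))
      + v 1 * (2 * (metricMatrix g e x).det *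
        (christoffel g e 0 1 0 x + christoffel g e 1 1 1 x)) := by
    conv_lhs => rw [eq_smul_single_add v]
    simp only [map_add, map_smul, smul_eq_mul, hp]
  have hpr : ∀ i : Fin 2, (EuclideanSpace.proj i : Plane →L[ℝ] ℝ) v = v i := fun _ => rfl
  simp only [Function.comp, _root_.add_apply, _root_.smul_apply, smul_eq_mul, hv, hs, hpr]
  clear h h' hsq hv hp
  -- With `r² = det g`, what remains is an identity of rational functions in `r`, where the
  -- Christoffel traces cancel.
  generalize √(metricMatrix g e x).det = r at *
  rw [← hss]
  field_simp
  ring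

end Killing

/-! ### Orientation and the area form. -/

section AreaForm

lemma isPositivePair_iff {V : Type*} [AddCommGroup V] [Module ℝ V]
    (o : _root_.Orientation ℝ V (Fin 2)) (b : Module.Basis (Fin 2) ℝ V) :
    IsPositivePair o (b 0) (b 1) ↔ b.orientation = o := by
  constructor
  · rintro ⟨b', h0, h1, h⟩
    have : b' = b := Module.Basis.eq_of_apply_eq fun i => by fin_cases i <;> assumption
    rwa [← this]
  · intro h
    exact ⟨b, rfl, rfl, h⟩

/-- A change of basis preserves positivity exactly if its determinant is positive. -/
lemma isPositivePair_smul_add_smul {V : Type*} [AddCommGroup V] [Module ℝ V]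
    (o : _root_.Orientation ℝ V (Fin 2)) {v w v' w' : V} (hV : Module.finrank ℝ V = 2)
    (h : LinearIndependent ℝ ![v, w]) (h' : LinearIndependent ℝ ![v', w']) {a b c d : ℝ}
    (hv : v' = a • v + b • w) (hw : w' = c • v + d • w) :
    IsPositivePair o v' w' ↔ (IsPositivePair o v w ↔ 0 < a * d - b * c) := by
  set B := basisOfLinearIndependentOfCardEqFinrank h (by simp [hV])
  set B' := basisOfLinearIndependentOfCardEqFinrank h' (by simp [hV])
  have hB0 : B 0 = v := by simp [B]
  have hB1 : B 1 = w := by simp [B]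
  have hB0' : B' 0 = v' := by simp [B']
  have hB1' : B' 1 = w' := by simp [B']
  have h1 := isPositivePair_iff o B
  have h2 := isPositivePair_iff o B'
  rw [hB0, hB1] at h1
  rw [hB0', hB1'] at h2
  have hr0 : B.repr v' = a • B.repr (B 0) + b • B.repr (B 1) := by
    rw [hB0, hB1, hv]; simp
  have hr1 : B.repr w' = c • B.repr (B 0) + d • B.repr (B 1) := by
    rw [hB0, hB1, hw]; simp
  have hdet : B.det B' = a * d - b * c := by
    rw [Module.Basis.det_apply, Matrix.det_fin_two]
    simp only [Module.Basis.toMatrix_apply, hB0', hB1', hr0, hr1]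
    simp
    ring
  -- A plane has only two orientations, so the claim reduces to a check of signs.
  rw [h1, h2, ← hdet, ← B.orientation_eq_iff_det_pos]
  rcases B.orientation_eq_or_eq_neg o with ho | ho <;>
    rcases B.orientation_eq_or_eq_neg B'.orientation with hb | hb <;>
    simp [ho, hb, Module.Ray.ne_neg_self, (Module.Ray.ne_neg_self _).symm]

variable {H : Type*} [TopologicalSpace H] {I : ModelWithCorners ℝ Plane H}
variable {M : Type*} [TopologicalSpace M] [ChartedSpace H M]

lemma finrank_tangentSpace (p : M) : Module.finrank ℝ (TangentSpace I p) = 2 :=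
  (finrank_euclideanSpace_fin : Module.finrank ℝ Plane = 2)

variable (o : SurfaceOrientation I M)

open Classical in
/-- The sign of the coordinate frame of the chart `e`. -/
noncomputable def frameSign (o : SurfaceOrientation I M) (e : OpenPartialHomeomorph M H)
    (x : Plane) : ℝ :=
  if IsPositivePair (o.at_point ((e.extend I).symm x)) (coordVec I e 0 x) (coordVec I e 1 x)
  then 1 else -1

lemma frameSign_eq_one_or (e : OpenPartialHomeomorph M H) (x : Plane) :
    frameSign o e x = 1 ∨ frameSign o e x = -1 := by
  unfold frameSign
  split_ifs <;> simp

/-- Lets the sign be treated as a constant when the vorticity is differentiated. -/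
lemma frameSign_eventually_eq {e : OpenPartialHomeomorph M H} (he : e ∈ atlas H M) {x : Plane}
    (hx : x ∈ (e.extend I).target) :
    ∀ᶠ y in 𝓝[range I] x, frameSign o e y = frameSign o e x := by
  filter_upwards [o.locally_constant e he x hx] with y hy
  unfold frameSign
  split_ifs with h1 h2 h2
  · rfl
  · exact absurd (hy.1 h1) h2
  · exact absurd (hy.2 h2) h1
  · rfl

variable [IsManifold I ∞ M] (g : Metric I M)

/-- The square root scales by the absolute value of the determinant and the orientation contributes
its sign; their product is the determinant. -/
lemma areaForm_smul_add_smul (p : M) {v w v' w' : TangentSpace I p}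
    (h : LinearIndependent ℝ ![v, w]) (h' : LinearIndependent ℝ ![v', w']) {a b c d : ℝ}
    (hv : v' = a • v + b • w) (hw : w' = c • v + d • w) :
    areaForm g o p v' w' = (a * d - b * c) * areaForm g o p v w := by
  have hpos := isPositivePair_smul_add_smul (o.at_point p) (finrank_tangentSpace p) h h' hv hw
  have hg : g.inner p v' v' * g.inner p w' w' - g.inner p v' w' ^ 2 =
      (a * d - b * c) ^ 2 * (g.inner p v v * g.inner p w w - g.inner p v w ^ 2) := by
    have hs := g.symm p w v
    subst hv hw
    simp only [map_add, map_smul, _root_.add_apply, _root_.smul_apply, smul_eq_mul, hs]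
    ring
  have hne : a * d - b * c ≠ 0 := by
    intro h0
    have := gram_pos g p h'
    rw [hg, h0] at this
    simp at this
  simp only [areaForm, hg, Real.sqrt_mul (sq_nonneg _), Real.sqrt_sq_eq_abs]
  rcases lt_or_gt_of_ne hne with hlt | hgt <;>
    by_cases hp : IsPositivePair (o.at_point p) v w
  · rw [if_pos hp, if_neg (fun h => hlt.not_gt ((hpos.1 h).1 hp)), abs_of_neg hlt]
    ring
  · rw [if_neg hp, if_pos (hpos.2 (iff_of_false hp hlt.not_gt)), abs_of_neg hlt]
    ring
  · rw [if_pos hp, if_pos (hpos.2 (iff_of_true hp hgt)), abs_of_pos hgt]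
  · rw [if_neg hp, if_neg (fun h => hp ((hpos.1 h).2 hgt)), abs_of_pos hgt]
    ring

lemma areaForm_coordVec (e : OpenPartialHomeomorph M H) (x : Plane) :
    areaForm g o ((e.extend I).symm x) (coordVec I e 0 x) (coordVec I e 1 x) =
      frameSign o e x * √(metricMatrix g e x).det := by
  rw [det_metricMatrix]
  simp only [areaForm, frameSign, metricCoeff]
  split_ifs <;> ring

end AreaForm

/-! ### Change of charts and invariance of the vorticity. -/

section Transition

variable {H : Type*} [TopologicalSpace H] {I : ModelWithCorners ℝ Plane H}
variable {M : Type*} [TopologicalSpace M] {e e' : OpenPartialHomeomorph M H} {y : Plane}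

lemma coordChange_mem (hy : y ∈ (I.extendCoordChange e' e).source) :
    y ∈ (e'.extend I).target ∧ I.extendCoordChange e' e y ∈ (e.extend I).target ∧
      (e.extend I).symm (I.extendCoordChange e' e y) = (e'.extend I).symm y := by
  rw [ModelWithCorners.extendCoordChange, PartialEquiv.trans_source] at hy
  exact ⟨hy.1, (e.extend I).map_source hy.2, (e.extend I).left_inv hy.2⟩

variable [ChartedSpace H M] [IsManifold I ∞ M] (g : Metric I M)

lemma contDiffWithinAt_coordChange (he : e ∈ atlas H M) (he' : e' ∈ atlas H M)
    (hy : y ∈ (I.extendCoordChange e' e).source) :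
    ContDiffWithinAt ℝ ∞ (I.extendCoordChange e' e) (range I) y :=
  I.contDiffWithinAt_extendCoordChange (IsManifold.subset_maximalAtlas he')
    (IsManifold.subset_maximalAtlas he) hy

/-- The coordinate vectors of two charts are related by the Jacobian matrix. -/
lemma coordVec_eq (he : e ∈ atlas H M) (he' : e' ∈ atlas H M)
    (hy : y ∈ (I.extendCoordChange e' e).source) (i : Fin 2) :
    (coordVec I e' i y : Plane) =
      partialD I i (fun z => I.extendCoordChange e' e z 0) y •
          (coordVec I e 0 (I.extendCoordChange e' e y) : Plane)
        + partialD I i (fun z => I.extendCoordChange e' e z 1) y •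
          (coordVec I e 1 (I.extendCoordChange e' e y) : Plane) := by
  set φ := I.extendCoordChange e' e with hφ
  obtain ⟨hy1, hy2, hy3⟩ := coordChange_mem hy
  have hr := mem_range_of_mem_target hy1
  have hd : DifferentiableWithinAt ℝ φ (range I) y :=
    (contDiffWithinAt_coordChange he he' hy).differentiableWithinAt (by simp)
  have hJ : ∀ a : Fin 2, partialD I i (fun z => φ z a) y =
      fderivWithin ℝ φ (range I) y (EuclideanSpace.single i 1) a := fun a =>
    partialD_of_hasFDerivWithinAt i hr
      ((EuclideanSpace.proj (𝕜 := ℝ) a).hasFDerivAt.comp_hasFDerivWithinAt y hd.hasFDerivWithinAt)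
  have hsrc : φ.source ∈ 𝓝[range I] y := I.extendCoordChange_source_mem_nhdsWithin hy
  have h1 : HasMFDerivWithinAt 𝓘(ℝ, Plane) I (e.extend I).symm (range I) (φ y)
      (mfderivWithin 𝓘(ℝ, Plane) I (e.extend I).symm (range I) (φ y)) :=
    ((contMDiffWithinAt_extend_symm he hy2).mdifferentiableWithinAt (by simp)).hasMFDerivWithinAt
  have h2 : HasMFDerivWithinAt 𝓘(ℝ, Plane) 𝓘(ℝ, Plane) φ φ.source y
      (fderivWithin ℝ φ (range I) y) :=
    (hd.hasFDerivWithinAt.mono (fun z hz => mem_range_of_mem_target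
      (coordChange_mem hz).1)).hasMFDerivWithinAt
  have h3 := h1.comp y h2 (fun z hz => mem_range_of_mem_target (coordChange_mem hz).2.1)
  have h4 := h3.mono_of_mem_nhdsWithin hsrc
  have h5 : HasMFDerivWithinAt 𝓘(ℝ, Plane) I (e'.extend I).symm (range I) y _ :=
    h4.congr_of_eventuallyEq (by
      filter_upwards [hsrc] with z hz
      exact (coordChange_mem hz).2.2.symm) hy3.symm
  have h6 := h5.mfderivWithin
    (uniqueMDiffWithinAt_iff_uniqueDiffWithinAt.2 (I.uniqueDiffOn _ hr))
  have h7 : (coordVec I e' i y : Plane) =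
      (mfderivWithin 𝓘(ℝ, Plane) I (e.extend I).symm (range I) (φ y) : Plane →L[ℝ] Plane)
        (fderivWithin ℝ φ (range I) y (EuclideanSpace.single i 1)) :=
    congrArg (fun L : Plane →L[ℝ] Plane => L (EuclideanSpace.single i (1 : ℝ))) h6
  rw [h7, hJ, hJ]
  set w : Plane := fderivWithin ℝ φ (range I) y (EuclideanSpace.single i 1)
  set B : Plane →L[ℝ] Plane := mfderivWithin 𝓘(ℝ, Plane) I (e.extend I).symm (range I) (φ y)
  have h8 : B w = w 0 • B (EuclideanSpace.single 0 (1 : ℝ))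
      + w 1 • B (EuclideanSpace.single 1 (1 : ℝ)) := by
    conv_lhs => rw [eq_smul_single_add w]
    simp only [map_add, map_smul]
  exact h8

lemma flatCoeff_coordChange (X : ∀ p : M, TangentSpace I p) (he : e ∈ atlas H M)
    (he' : e' ∈ atlas H M) (hy : y ∈ (I.extendCoordChange e' e).source) (i : Fin 2) :
    flatCoeff g X e' i y =
      partialD I i (fun z => I.extendCoordChange e' e z 0) y *
          flatCoeff g X e 0 (I.extendCoordChange e' e y)
        + partialD I i (fun z => I.extendCoordChange e' e z 1) y *
          flatCoeff g X e 1 (I.extendCoordChange e' e y) := by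
  -- The two expressions for the base point are only propositionally equal; taking `u` in `Plane`
  -- avoids a transport between tangent spaces.
  have hc : ∀ (p p' : M) (_ : p = p') (u : Plane), g.inner p (X p) u = g.inner p' (X p') u := by
    rintro p _ rfl u
    rfl
  have h3 := (coordChange_mem hy).2.2
  have h := coordVec_eq he he' hy i
  have h1 : flatCoeff g X e' i y = g.inner ((e.extend I).symm (I.extendCoordChange e' e y))
      (X ((e.extend I).symm (I.extendCoordChange e' e y))) (coordVec I e' i y : Plane) :=
    hc _ _ h3.symm _
  rw [h1, h]
  exact ((g.inner _ _).map_add _ _).trans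
    (congrArg₂ (· + ·) ((g.inner _ _).map_smul _ _) ((g.inner _ _).map_smul _ _))

/-- The curl transforms by the Jacobian determinant under a change of charts. -/
lemma curl_coordChange {X : ∀ p : M, TangentSpace I p}
    (hX : ContMDiff I I.tangent 1 (fun p : M => (⟨p, X p⟩ : TangentBundle I M)))
    (he : e ∈ atlas H M) (he' : e' ∈ atlas H M) (hy : y ∈ (I.extendCoordChange e' e).source) :
    curl g X e' y =
      (partialD I 0 (fun z => I.extendCoordChange e' e z 0) y *
          partialD I 1 (fun z => I.extendCoordChange e' e z 1) y
        - partialD I 0 (fun z => I.extendCoordChange e' e z 1) y *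
          partialD I 1 (fun z => I.extendCoordChange e' e z 0) y) *
        curl g X e (I.extendCoordChange e' e y) := by
  set φ := I.extendCoordChange e' e with hφ
  obtain ⟨hy1, hy2, hy3⟩ := coordChange_mem hy
  have hr := mem_range_of_mem_target hy1
  have hd := contDiffWithinAt_coordChange he he' hy
  have hda : ∀ a : Fin 2, ContDiffWithinAt ℝ ∞ (fun z => φ z a) (range I) y :=
    fun a => contDiffWithinAt_euclidean.1 hd a
  have hsrc : φ.source ∈ 𝓝[range I] y := I.extendCoordChange_source_mem_nhdsWithin hy
  have hmaps : ∀ᶠ z in 𝓝[range I] y, φ z ∈ range I := by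
    filter_upwards [hsrc] with z hz
    exact mem_range_of_mem_target (coordChange_mem hz).2.1
  have hF : ∀ a, DifferentiableWithinAt ℝ (flatCoeff g X e a) (range I) (φ y) := fun a =>
    (contDiffWithinAt_flatCoeff g hX he a hy2).differentiableWithinAt (by simp)
  have hdφ : DifferentiableWithinAt ℝ φ (range I) y := hd.differentiableWithinAt (by simp)
  have hFφ : ∀ a, DifferentiableWithinAt ℝ (fun z => flatCoeff g X e a (φ z)) (range I) y := by
    intro a
    exact ((hF a).comp y (hdφ.mono (s := range I ∩ φ ⁻¹' range I) inter_subset_left)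
      (fun z hz => hz.2)).mono_of_mem_nhdsWithin (inter_mem self_mem_nhdsWithin hmaps)
  have hJ : ∀ i a, DifferentiableWithinAt ℝ (partialD I i (fun z => φ z a)) (range I) y :=
    fun i a => ((hda a).partialD (m := ∞) i (by simp) hr).differentiableWithinAt (by simp)
  have hp : ∀ k i, partialD I k (flatCoeff g X e' i) y =
      partialD I i (fun z => φ z 0) y * partialD I k (fun z => flatCoeff g X e 0 (φ z)) y
        + flatCoeff g X e 0 (φ y) * partialD I k (partialD I i (fun z => φ z 0)) y
      + (partialD I i (fun z => φ z 1) y * partialD I k (fun z => flatCoeff g X e 1 (φ z)) y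
        + flatCoeff g X e 1 (φ y) * partialD I k (partialD I i (fun z => φ z 1)) y) := by
    intro k i
    rw [partialD_congr (h := fun z => partialD I i (fun z => φ z 0) z * flatCoeff g X e 0 (φ z)
        + partialD I i (fun z => φ z 1) z * flatCoeff g X e 1 (φ z)) k
      (by filter_upwards [hsrc] with z hz
          exact flatCoeff_coordChange g X he he' hz i) hr,
      partialD_add k hr ((hJ _ _).fun_mul (hFφ _)) ((hJ _ _).fun_mul (hFφ _)),
      partialD_mul k hr (hJ _ _) (hFφ _), partialD_mul k hr (hJ _ _) (hFφ _)]
  -- The second derivatives of the coordinate change are symmetric and drop out of the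
  -- antisymmetrization.
  have hcomm : ∀ a, partialD I 0 (partialD I 1 (fun z => φ z a)) y =
      partialD I 1 (partialD I 0 (fun z => φ z a)) y := fun a =>
    partialD_comm 0 ((hda a).of_le (WithTop.coe_le_coe.2 le_top)) hr 1
  rw [curl, curl, hp, hp, partialD_comp 0 hr hdφ hmaps (hF 0), partialD_comp 0 hr hdφ hmaps (hF 1),
    partialD_comp 1 hr hdφ hmaps (hF 0), partialD_comp 1 hr hdφ hmaps (hF 1), hcomm, hcomm]
  ring

/-- The vorticity can be computed in any chart. -/
lemma vorticity_eq {X : ∀ p : M, TangentSpace I p} (o : SurfaceOrientation I M)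
    (hX : ContMDiff I I.tangent 1 (fun p : M => (⟨p, X p⟩ : TangentBundle I M)))
    (he : e ∈ atlas H M) {x : Plane} (hx : x ∈ (e.extend I).target) :
    vorticity g o X ((e.extend I).symm x) = frameSign o e x * chartVorticity g X e x := by
  set q := (e.extend I).symm x with hq
  set e' := chartAt H q with he'_def
  have he' : e' ∈ atlas H M := chart_mem_atlas H q
  set y := e'.extend I q with hy_def
  have hqe' : q ∈ e'.source := mem_chart_source H q
  have hqe : q ∈ e.source := symm_mem_source hx
  have hy : y ∈ (I.extendCoordChange e' e).source := by
    rw [← OpenPartialHomeomorph.extend_image_source_inter]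
    exact mem_image_of_mem _ ⟨hqe', hqe⟩
  have hyq : (e'.extend I).symm y = q := e'.extend_left_inv hqe'
  have hφ : I.extendCoordChange e' e y = x := by
    change e.extend I ((e'.extend I).symm y) = x
    rw [hyq, hq, (e.extend I).right_inv hx]
  have hy1 := (coordChange_mem hy).1
  have hcurl := curl_coordChange g hX he he' hy
  have hv0 := coordVec_eq he he' hy 0
  have hv1 := coordVec_eq he he' hy 1
  rw [hφ] at hcurl hv0 hv1
  set a := partialD I 0 (fun z => I.extendCoordChange e' e z 0) y
  set b := partialD I 0 (fun z => I.extendCoordChange e' e z 1) y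
  set c := partialD I 1 (fun z => I.extendCoordChange e' e z 0) y
  set d := partialD I 1 (fun z => I.extendCoordChange e' e z 1) y
  have hA : ∀ (p p' : M) (_ : p = p') (u v : Plane), areaForm g o p u v = areaForm g o p' u v := by
    rintro p _ rfl u v
    rfl
  have harea : areaForm g o ((e'.extend I).symm y) (coordVec I e' 0 y) (coordVec I e' 1 y) =
      (a * d - b * c) * (frameSign o e x * √(metricMatrix g e x).det) := by
    rw [← areaForm_coordVec]
    refine (hA _ _ hyq _ _).trans ?_
    exact areaForm_smul_add_smul o g q (linearIndependent_coordVec he hx)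
      (linearIndependent_coordVec he' hy1) hv0 hv1
  -- The area form is nonzero on the frame of `e'`, so the Jacobian determinant cannot vanish. It
  -- then cancels between the curl and the area.
  have hne : a * d - b * c ≠ 0 := by
    intro h0
    rw [areaForm_coordVec, h0, zero_mul] at harea
    have h1 := (Real.sqrt_pos.2 (det_metricMatrix_pos g he' hy1)).ne'
    rcases frameSign_eq_one_or o e' y with h | h <;> simp [h, h1] at harea
  have hvort : vorticity g o X q = curl g X e' y /
      areaForm g o ((e'.extend I).symm y) (coordVec I e' 0 y) (coordVec I e' 1 y) := rfl
  have hD := (Real.sqrt_pos.2 (det_metricMatrix_pos g he hx)).ne'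
  rw [hvort, harea, hcurl, chartVorticity, mul_div_mul_left _ _ hne]
  -- The sign is its own inverse, so dividing by it is multiplying by it.
  rcases frameSign_eq_one_or o e x with h | h <;> rw [h] <;> field_simp

end Transition

/-! ### Constancy from a vanishing derivative at interior points. -/

section LocallyConstant

variable {H : Type*} [TopologicalSpace H] {I : ModelWithCorners ℝ Plane H}
variable {M : Type*} [TopologicalSpace M] [ChartedSpace H M]

/-- A function on a connected surface that is continuous in charts and has zero derivative at the
interior points of charts is constant. -/
lemma eq_of_hasFDerivAt_zero [ConnectedSpace M] {f : M → ℝ}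
    (hc : ∀ p : M, ∀ x ∈ ((chartAt H p).extend I).target,
      ContinuousWithinAt (fun y => f (((chartAt H p).extend I).symm y)) (range I) x)
    (hd : ∀ p : M, ∀ x ∈ ((chartAt H p).extend I).target, x ∈ interior (range I) →
      HasFDerivAt (fun y => f (((chartAt H p).extend I).symm y)) (0 : Plane →L[ℝ] ℝ) x)
    (p q : M) : f p = f q := by
  have hf : IsLocallyConstant f := by
    rw [IsLocallyConstant.iff_eventually_eq]
    intro p
    set e := chartAt H p with he
    set F : Plane → ℝ := fun y => f ((e.extend I).symm y) with hF
    have hp : p ∈ e.source := mem_chart_source H p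
    have hx := extend_mem_target (I := I) hp
    obtain ⟨r, hr, hball⟩ := Metric.mem_nhdsWithin_iff.1 (extend_target_mem_nhdsWithin_range e hx)
    -- The ball intersected with the interior of the model set is convex, so zero derivative gives
    -- constancy there. Its closure contains the boundary points in the ball, which continuity then
    -- handles.
    set C := Metric.ball (e.extend I p) r ∩ interior (range I) with hC
    have hCo : IsOpen C := Metric.isOpen_ball.inter isOpen_interior
    have hCc : Convex ℝ C := (convex_ball _ _).inter I.convex_range.interior
    have hCT : C ⊆ (e.extend I).target := fun y hy => hball ⟨hy.1, interior_subset hy.2⟩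
    have hcl : Metric.ball (e.extend I p) r ∩ range I ⊆ closure C := by
      intro y hy
      exact Metric.isOpen_ball.inter_closure ⟨hy.1, I.range_subset_closure_interior hy.2⟩
    have hpm : e.extend I p ∈ Metric.ball (e.extend I p) r ∩ range I :=
      ⟨Metric.mem_ball_self hr, mem_range_of_mem_target hx⟩
    obtain ⟨z, hz⟩ : C.Nonempty := closure_nonempty_iff.1 ⟨_, hcl hpm⟩
    have hconst : ∀ y ∈ C, F y = F z := by
      intro y hy
      refine hCo.is_const_of_fderiv_eq_zero (𝕜 := ℝ) hCc.isPreconnected ?_ ?_ hy hz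
      · exact fun w hw => (hd p w (hCT hw) hw.2).differentiableAt.differentiableWithinAt
      · exact fun w hw => (hd p w (hCT hw) hw.2).fderiv
    have hconst' : ∀ y ∈ Metric.ball (e.extend I p) r ∩ range I, F y = F z := by
      intro y hy
      have : (𝓝[C] y).NeBot := mem_closure_iff_nhdsWithin_neBot.1 (hcl hy)
      have h1 : Tendsto F (𝓝[C] y) (𝓝 (F y)) :=
        (hc p y (hball hy)).mono (fun w hw => interior_subset hw.2)
      refine tendsto_nhds_unique h1 (tendsto_const_nhds.congr' ?_)
      filter_upwards [self_mem_nhdsWithin] with w hw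
      exact (hconst w hw).symm
    have hcont : ∀ᶠ q in 𝓝 p, e.extend I q ∈ Metric.ball (e.extend I p) r :=
      (e.continuousAt_extend hp).eventually (Metric.ball_mem_nhds _ hr)
    filter_upwards [hcont, e.open_source.mem_nhds hp] with q hq hqs
    have h1 := hconst' _ ⟨hq, mem_range_of_mem_target (extend_mem_target hqs)⟩
    have h2 := hconst' _ hpm
    simp only [hF, e.extend_left_inv hqs, e.extend_left_inv hp] at h1 h2
    rw [h1, h2]
  exact hf.apply_eq_of_preconnectedSpace p q

end LocallyConstant

/-! ### The two implications. -/

section Vorticity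

variable {H : Type*} [TopologicalSpace H] {I : ModelWithCorners ℝ Plane H}
variable {M : Type*} [TopologicalSpace M] [ChartedSpace H M] [IsManifold I ∞ M]
variable (g : Metric I M) (o : SurfaceOrientation I M) {e : OpenPartialHomeomorph M H} {x : Plane}
variable {X : ∀ p : M, TangentSpace I p}

lemma vorticity_eventuallyEq
    (hX : ContMDiff I I.tangent 1 (fun p : M => (⟨p, X p⟩ : TangentBundle I M)))
    (he : e ∈ atlas H M) (hx : x ∈ (e.extend I).target) :
    ∀ᶠ y in 𝓝[range I] x, vorticity g o X ((e.extend I).symm y) =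
      frameSign o e x * chartVorticity g X e y := by
  filter_upwards [extend_target_mem_nhdsWithin_range e hx, frameSign_eventually_eq o he hx]
    with y hy hs
  rw [vorticity_eq g o hX he hy, hs]

lemma continuousWithinAt_vorticity
    (hX : ContMDiff I I.tangent 1 (fun p : M => (⟨p, X p⟩ : TangentBundle I M)))
    (he : e ∈ atlas H M) (hx : x ∈ (e.extend I).target) :
    ContinuousWithinAt (fun y => vorticity g o X ((e.extend I).symm y)) (range I) x :=
  ((continuousWithinAt_chartVorticity g hX he hx).const_smul (frameSign o e x)).congr_of_eventuallyEq
    (vorticity_eventuallyEq g o hX he hx) (vorticity_eq g o hX he hx)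

lemma IsHydrodynamicKilling.hasFDerivAt_vorticity (hX : IsHydrodynamicKilling g X)
    (he : e ∈ atlas H M) (hx : x ∈ (e.extend I).target) (hi : x ∈ interior (range I)) :
    HasFDerivAt (fun y => vorticity g o X ((e.extend I).symm y))
      (frameSign o e x • (2 * curvatureNum g e x / √(metricMatrix g e x).det) •
        (-vecCoeff I e X 1 x • EuclideanSpace.proj 0
          + vecCoeff I e X 0 x • EuclideanSpace.proj 1) : Plane →L[ℝ] ℝ) x := by
  refine ((hX.hasFDerivAt_chartVorticity g he hx hi).const_smul
    (frameSign o e x)).congr_of_eventuallyEq ?_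
  have h := vorticity_eventuallyEq g o hX.contMDiff he hx
  rwa [nhdsWithin_eq_nhds.2 (mem_interior_iff_mem_nhds.1 hi)] at h

/-- On a flat surface the vorticity of a Killing field has zero derivative in every chart. -/
lemma IsHydrodynamicKilling.hasFDerivAt_vorticity_zero (hX : IsHydrodynamicKilling g X)
    (hK : ∀ p : M, gaussCurvature g p = 0) (he : e ∈ atlas H M) (hx : x ∈ (e.extend I).target)
    (hi : x ∈ interior (range I)) :
    HasFDerivAt (fun y => vorticity g o X ((e.extend I).symm y)) (0 : Plane →L[ℝ] ℝ) x := by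
  set q := (e.extend I).symm x with hq
  -- The hypothesis concerns the curvature in the preferred chart at `q`, so the derivative is shown
  -- to vanish in that chart and is then pulled back by the chain rule.
  set e' := chartAt H q with he'_def
  have he' : e' ∈ atlas H M := chart_mem_atlas H q
  have hqe' : q ∈ e'.source := mem_chart_source H q
  have hqe : q ∈ e.source := symm_mem_source hx
  have hxq : e.extend I q = x := (e.extend I).right_inv hx
  set y := e'.extend I q with hy_def
  have hyT : y ∈ (e'.extend I).target := extend_mem_target hqe'
  -- Being an interior point does not depend on the chart.
  have hyi : y ∈ interior (range I) := by
    have h1 : e.extend I q ∈ interior (e.extend I).target :=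
      e.mem_interior_extend_target (e.map_source hqe) (by
        change e.extend I q ∈ interior (range I)
        rwa [hxq])
    exact e'.interior_extend_target_subset_interior_range
      ((ModelWithCorners.mem_interior_range_iff_of_mem_atlas (n := ∞) (by simp) he he' hqe
        hqe').1 h1)
  have hnum : curvatureNum g e' y = 0 := by
    have h1 : curvatureNum g e' y / (metricMatrix g e' y).det = 0 := hK q
    exact (div_eq_zero_iff.1 h1).resolve_right (det_metricMatrix_pos g he' hyT).ne'
  have h1 := hX.hasFDerivAt_vorticity g o he' hyT hyi
  rw [hnum] at h1
  have hxs : x ∈ (I.extendCoordChange e e').source := by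
    rw [← hxq, ← OpenPartialHomeomorph.extend_image_source_inter]
    exact mem_image_of_mem _ ⟨hqe, hqe'⟩
  have hφ : DifferentiableAt ℝ (I.extendCoordChange e e') x :=
    ((contDiffWithinAt_coordChange he' he hxs).differentiableWithinAt (by simp)).differentiableAt
      (mem_interior_iff_mem_nhds.1 hi)
  have hφx : I.extendCoordChange e e' x = y := rfl
  rw [← hφx] at h1
  have h2 := h1.comp x hφ.hasFDerivAt
  have hsrc := I.extendCoordChange_source_mem_nhdsWithin hxs
  rw [nhdsWithin_eq_nhds.2 (mem_interior_iff_mem_nhds.1 hi)] at hsrc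
  refine (h2.congr_of_eventuallyEq ?_).congr_fderiv (by simp)
  filter_upwards [hsrc] with z hz
  simp only [Function.comp, (coordChange_mem hz).2.2]

/-- The squared length of a Killing field without vorticity is constant. -/
lemma IsHydrodynamicKilling.inner_self_eq [ConnectedSpace M] (hX : IsHydrodynamicKilling g X)
    (hcurl : ∀ e ∈ atlas H M, ∀ x ∈ (e.extend I).target, curl g X e x = 0) (p q : M) :
    g.inner p (X p) (X p) = g.inner q (X q) (X q) := by
  have hN : ∀ e ∈ atlas H M, ∀ x ∈ (e.extend I).target,
      g.inner ((e.extend I).symm x) (X ((e.extend I).symm x)) (X ((e.extend I).symm x)) =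
        vecCoeff I e X 0 x * flatCoeff g X e 0 x + vecCoeff I e X 1 x * flatCoeff g X e 1 x := by
    intro e he x hx
    have hlin : ∀ (p : M) (u v w : TangentSpace I p) (a b : ℝ), w = a • u + b • v →
        g.inner p w w = a * g.inner p w u + b * g.inner p w v := by
      intro p u v w a b h
      calc g.inner p w w = g.inner p w (a • u + b • v) := by rw [← h]
        _ = _ := by rw [map_add, map_smul, map_smul, smul_eq_mul, smul_eq_mul]
    exact hlin _ _ _ _ _ _ (eq_sum_vecCoeff_smul he X hx)
  have hC : ∀ e ∈ atlas H M, ∀ x ∈ (e.extend I).target, ContDiffWithinAt ℝ 1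
      (fun y => vecCoeff I e X 0 y * flatCoeff g X e 0 y + vecCoeff I e X 1 y * flatCoeff g X e 1 y)
      (range I) x := fun e he x hx =>
    ((contDiffWithinAt_vecCoeff hX.contMDiff he 0 hx).mul
      (contDiffWithinAt_flatCoeff g hX.contMDiff he 0 hx)).add
    ((contDiffWithinAt_vecCoeff hX.contMDiff he 1 hx).mul
      (contDiffWithinAt_flatCoeff g hX.contMDiff he 1 hx))
  have hev : ∀ e ∈ atlas H M, ∀ x ∈ (e.extend I).target, ∀ᶠ y in 𝓝[range I] x,
      g.inner ((e.extend I).symm y) (X ((e.extend I).symm y)) (X ((e.extend I).symm y)) =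
        vecCoeff I e X 0 y * flatCoeff g X e 0 y + vecCoeff I e X 1 y * flatCoeff g X e 1 y := by
    intro e he x hx
    filter_upwards [extend_target_mem_nhdsWithin_range e hx] with y hy
    exact hN e he y hy
  refine eq_of_hasFDerivAt_zero (H := H) (I := I) (f := fun p => g.inner p (X p) (X p))
    (fun p x hx => ?_) (fun p x hx hi => ?_) p q
  · have he := chart_mem_atlas H p
    exact (hC _ he x hx).continuousWithinAt.congr_of_eventuallyEq (hev _ he x hx) (hN _ he x hx)
  · set e := chartAt H p
    have he : e ∈ atlas H M := chart_mem_atlas H p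
    have hr := mem_range_of_mem_target hx
    have hd := ((hC e he x hx).contDiffAt (mem_interior_iff_mem_nhds.1 hi)).differentiableAt
      (by simp)
    have hev' := hev e he x hx
    rw [nhdsWithin_eq_nhds.2 (mem_interior_iff_mem_nhds.1 hi)] at hev'
    refine (hd.hasFDerivAt.congr_of_eventuallyEq hev').congr_fderiv ?_
    have dV : ∀ a, DifferentiableWithinAt ℝ (vecCoeff I e X a) (range I) x := fun a =>
      (contDiffWithinAt_vecCoeff hX.contMDiff he a hx).differentiableWithinAt (by simp)
    have dF : ∀ a, DifferentiableWithinAt ℝ (flatCoeff g X e a) (range I) x := fun a =>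
      (contDiffWithinAt_flatCoeff g hX.contMDiff he a hx).differentiableWithinAt (by simp)
    have hL := fun i j => hX.lieDeriv_eq_zero e he x hx i j
    simp only [lieDerivMetric, Fin.sum_univ_two] at hL
    have hcx := hcurl e he x hx
    have hs : metricCoeff g e 1 0 = metricCoeff g e 0 1 := funext (metricCoeff_symm g e 1 0)
    have L00 := hL 0 0
    have L01 := hL 0 1
    have L11 := hL 1 1
    -- Half the derivative of `|X|²` pairs the covariant derivative of `X` with `X`: the Killing
    -- equation removes its symmetric part, the vanishing curl its antisymmetric part.
    have key : ∀ k, fderiv ℝ (fun y => vecCoeff I e X 0 y * flatCoeff g X e 0 y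
        + vecCoeff I e X 1 y * flatCoeff g X e 1 y) x (EuclideanSpace.single k 1) = 0 := by
      intro k
      rw [← partialD_eq_fderiv k hi,
        partialD_add k hr ((dV _).fun_mul (dF _)) ((dV _).fun_mul (dF _)),
        partialD_mul k hr (dV _) (dF _), partialD_mul k hr (dV _) (dF _)]
      simp only [curl, partialD_flatCoeff g he hx hX.contMDiff, flatCoeff_eq g he X _ hx, hs]
        at hcx L00 L01 L11 ⊢
      fin_cases k
      · simp only [Fin.zero_eta, Fin.isValue]
        linear_combination vecCoeff I e X 0 x * L00 + vecCoeff I e X 1 x * L01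
          + vecCoeff I e X 1 x * hcx
      · simp only [Fin.mk_one, Fin.isValue]
        linear_combination vecCoeff I e X 0 x * L01 + vecCoeff I e X 1 x * L11
          - vecCoeff I e X 0 x * hcx
    ext v
    rw [eq_smul_single_add v]
    simp only [map_add, map_smul, key]
    simp

lemma IsHydrodynamicKilling.gaussCurvature_eq_zero [ConnectedSpace M]
    (hX : IsHydrodynamicKilling g X) {c : ℝ} (hc : ∀ p : M, vorticity g o X p = c) (p : M) :
    gaussCurvature g p = 0 := by
  set e := chartAt H p with he_def
  have he : e ∈ atlas H M := chart_mem_atlas H p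
  have hp : p ∈ e.source := mem_chart_source H p
  set x := e.extend I p
  have hx : x ∈ (e.extend I).target := extend_mem_target hp
  by_contra hK
  have hnum : curvatureNum g e x ≠ 0 := by
    intro h0
    refine hK ?_
    change curvatureNum g e x / (metricMatrix g e x).det = 0
    rw [h0, zero_div]
  -- Constant vorticity has zero derivative, so `2 K ι_X dVol = 0`, which forces `X = 0` wherever `K
  -- ≠ 0`.
  have hV : ∀ y ∈ (e.extend I).target, y ∈ interior (range I) → curvatureNum g e y ≠ 0 →
      ∀ k, vecCoeff I e X k y = 0 := by
    intro y hy hi hn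
    have h1 := hX.hasFDerivAt_vorticity g o he hy hi
    simp only [hc] at h1
    have h2 := h1.unique (hasFDerivAt_const c y)
    have hs : frameSign o e y ≠ 0 := by
      rcases frameSign_eq_one_or o e y with h | h <;> rw [h] <;> norm_num
    have hD := (Real.sqrt_pos.2 (det_metricMatrix_pos g he hy)).ne'
    rw [smul_smul, smul_eq_zero] at h2
    have h3 := h2.resolve_left (mul_ne_zero hs (div_ne_zero (mul_ne_zero two_ne_zero hn) hD))
    have h30 := congrArg (fun L : Plane →L[ℝ] ℝ => L (EuclideanSpace.single 0 1)) h3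
    have h31 := congrArg (fun L : Plane →L[ℝ] ℝ => L (EuclideanSpace.single 1 1)) h3
    simp at h30 h31
    intro k
    fin_cases k
    · exact h31
    · exact h30
  -- The point `p` may lie on the boundary, so a nearby interior point is used, with a full
  -- neighbourhood on which `X` vanishes.
  obtain ⟨y, hyi, hyev⟩ : ∃ y ∈ interior (range I), ∀ᶠ z in 𝓝 y,
      z ∈ (e.extend I).target ∧ ∀ k, vecCoeff I e X k z = 0 := by
    have hev : ∀ᶠ z in 𝓝[range I] x, z ∈ (e.extend I).target ∧ curvatureNum g e z ≠ 0 :=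
      (show ∀ᶠ z in 𝓝[range I] x, z ∈ (e.extend I).target from
        extend_target_mem_nhdsWithin_range e hx).and
        ((continuousWithinAt_curvatureNum g he hx).eventually_ne hnum)
    obtain ⟨r, hr, hball⟩ := Metric.mem_nhdsWithin_iff.1 hev
    obtain ⟨y, hy⟩ : (Metric.ball x r ∩ interior (range I)).Nonempty :=
      mem_closure_iff_nhds.1 (I.range_subset_closure_interior (mem_range_of_mem_target hx)) _
        (Metric.ball_mem_nhds x hr)
    refine ⟨y, hy.2, ?_⟩
    filter_upwards [(Metric.isOpen_ball.inter isOpen_interior).mem_nhds hy] with z hz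
    have hz' := hball ⟨hz.1, interior_subset hz.2⟩
    exact ⟨hz'.1, hV z hz'.1 hz.2 hz'.2⟩
  obtain ⟨hyT, hyV⟩ := hyev.self_of_nhds
  have hflat : ∀ i k, partialD I k (flatCoeff g X e i) y = 0 := by
    intro i k
    have : flatCoeff g X e i =ᶠ[𝓝 y] fun _ => 0 := by
      filter_upwards [hyev] with z hz
      rw [flatCoeff_eq g he X i hz.1, hz.2, hz.2]
      ring
    rw [partialD_eq_fderiv k hyi, this.fderiv_eq]
    simp
  -- The constant is read off at `y`, near which `X♭` is identically zero.
  have hc0 : c = 0 := by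
    rw [← hc ((e.extend I).symm y), vorticity_eq g o hX.contMDiff he hyT, chartVorticity, curl,
      hflat, hflat]
    simp
  have hcurl : ∀ e' ∈ atlas H M, ∀ z ∈ (e'.extend I).target, curl g X e' z = 0 := by
    intro e' he' z hz
    have h1 := vorticity_eq g o hX.contMDiff he' hz
    have hs : frameSign o e' z ≠ 0 := by
      rcases frameSign_eq_one_or o e' z with h | h <;> rw [h] <;> norm_num
    have hD := (Real.sqrt_pos.2 (det_metricMatrix_pos g he' hz)).ne'
    rw [hc, hc0, chartVorticity, eq_comm] at h1
    exact (div_eq_zero_iff.1 ((mul_eq_zero.1 h1).resolve_left hs)).resolve_right hD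
  obtain ⟨q, hq⟩ := hX.nontrivial
  have hXy : X ((e.extend I).symm y) = 0 := by
    rw [eq_sum_vecCoeff_smul he X hyT, hyV, hyV]
    rw [zero_smul, zero_smul, add_zero]
  -- The constant length of `X` is zero at `y`, contradicting its positivity at `q`.
  have h := hX.inner_self_eq g hcurl q ((e.extend I).symm y)
  rw [hXy, map_zero] at h
  exact (g.pos q (X q) hq).ne' h

end Vorticity

end Surf

theorem mainTheorem11 {H : Type*} [TopologicalSpace H]
    (I : ModelWithCorners ℝ Surf.Plane H) (hI : Surf.IsSurfaceModel I)
    (M : Type*) [TopologicalSpace M] [T2Space M] [ConnectedSpace M]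
    [ChartedSpace H M] [IsManifold I ∞ M]
    (g : Surf.Metric I M) (o : Surf.SurfaceOrientation I M)
    (X : ∀ p : M, TangentSpace I p) (hX : Surf.IsHydrodynamicKilling g X) :
    (∃ c : ℝ, ∀ p : M, Surf.vorticity g o X p = c) ↔
      ∀ p : M, Surf.gaussCurvature g p = 0 := by
  constructor
  · rintro ⟨c, hc⟩
    exact hX.gaussCurvature_eq_zero g o hc
  · intro hK
    obtain ⟨p₀⟩ : Nonempty M := inferInstance
    refine ⟨Surf.vorticity g o X p₀, fun p => ?_⟩
    exact Surf.eq_of_hasFDerivAt_zero (H := H) (I := I) (f := Surf.vorticity g o X)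
      (fun q x hx => Surf.continuousWithinAt_vorticity g o hX.contMDiff (chart_mem_atlas H q) hx)
      (fun q x hx hi => hX.hasFDerivAt_vorticity_zero g o hK (chart_mem_atlas H q) hx hi) p p₀
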